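/- **Theorem.** Let $n\ge 2$ and $r\ge 1$, let $\mathcal B_m$ denote Artin's braid group on $m$ strands, and let $H\le\mathcal B_n$ be a finitely generated subgroup. Then the braided Higman–Thompson group $BV_{n,r}(H)$ on $r$ copies of the $n$-adic Cantor set, with recursive braids of type $H$, is finitely generated. Here $BV_{n,r}(H)$ is the following group. Its elements are represented by quadruples $(T,\beta,\lambda,T')$, where $T$ and $T'$ are forests of $r$ finite full $n$-ary trees with the same number $m$ of leaves (ordered from left to right), $\beta\in\mathcal B_m$ is a braid from the leaves of $T$ to the leaves of $T'$, and $\lambda=(h_1,\dots,h_m)\in H^m$ assigns the label $h_i$ to the strand of $\beta$ that ends at the $i$-th leaf of $T'$. An *expansion* of $(T,\beta,\lambda,T')$ at the $i$-th leaf of $T'$ is obtained by appending a caret (that is, $n$ children) to this leaf and to the leaf of $T$ joined to it by $\beta$, replacing the strand of $\beta$ between them by $n$ parallel strands which are then braided among themselves by $h_i$, giving each of these $n$ strands the label $h_i$, and keeping all other labels. Two quadruples represent the same element if they are related by the equivalence relation generated by expansions. Any two elements have representatives of the form $(T,\beta,\lambda,T')$ and $(T',\beta',\lambda',T'')$, and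 their product is represented by $(T,\beta\beta',\lambda\lambda',T'')$, where the label in $\lambda\lambda'$ of a strand of $\beta\beta'$ is the product of the label in $\lambda$ of its $\beta$-part and the label in $\lambda'$ of its $\beta'$-part. -/

import Mathlib

namespace BraidedThompson

/-! ## Braid groups -/

/-- The defining relations of the braid group on `m` strands; the Artin generators `σ_0, …, σ_{m-2}`
are numbered from `0`. -/
def braidRels (m : ℕ) : Set (FreeGroup (Fin (m - 1))) :=
  {w | ∃ i j : Fin (m - 1), (i : ℕ) + 1 < j ∧
      w = FreeGroup.of i * FreeGroup.of j * (FreeGroup.of j * FreeGroup.of i)⁻¹} ∪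
  {w | ∃ i j : Fin (m - 1), (i : ℕ) + 1 = j ∧
      w = FreeGroup.of i * FreeGroup.of j * FreeGroup.of i *
        (FreeGroup.of j * FreeGroup.of i * FreeGroup.of j)⁻¹}

/-- The braid group on `m` strands, in Artin's presentation. Products of braids are read from top
to bottom. -/
abbrev BraidGroup (m : ℕ) : Type := PresentedGroup (braidRels m)

/-- The Artin generator `σ_k` (`0 ≤ k < m - 1`), in which the strand in position `k` passes over the
strand in position `k + 1`; by convention it is `1` when `k` is out of range. -/
def sigma (m k : ℕ) : BraidGroup m :=
  if h : k < m - 1 then PresentedGroup.of ⟨k, h⟩ else 1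

theorem sigma_comm (m : ℕ) {i j : ℕ} (h : i + 1 < j) :
    sigma m i * sigma m j = sigma m j * sigma m i := by
  unfold sigma
  split_ifs with h1 h2
  · have := PresentedGroup.one_of_mem (rels := braidRels m) (Or.inl ⟨⟨i, h1⟩, ⟨j, h2⟩, h, rfl⟩)
    simp only [map_mul, map_inv] at this
    exact mul_inv_eq_one.1 this
  all_goals simp

theorem sigma_braid (m : ℕ) {i : ℕ} (h : i + 2 < m) :
    sigma m i * sigma m (i + 1) * sigma m i =
      sigma m (i + 1) * sigma m i * sigma m (i + 1) := by
  unfold sigma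
  rw [dif_pos (by omega), dif_pos (by omega)]
  have := PresentedGroup.one_of_mem (rels := braidRels m)
    (Or.inr ⟨⟨i, by omega⟩, ⟨i + 1, by omega⟩, rfl, rfl⟩)
  simp only [map_mul, map_inv] at this
  exact mul_inv_eq_one.1 this

/-- The homomorphism out of a braid group given by images of the Artin generators that satisfy the
braid relations. -/
def braidLift {G : Type} [Group G] (m : ℕ) (s : ℕ → G)
    (hc : ∀ i j, i + 1 < j → j + 1 < m → s i * s j = s j * s i)
    (hb : ∀ i, i + 2 < m → s i * s (i + 1) * s i = s (i + 1) * s i * s (i + 1)) :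
    BraidGroup m →* G :=
  PresentedGroup.toGroup (f := fun i : Fin (m - 1) => s i) (by
    rintro w (⟨i, j, h, rfl⟩ | ⟨i, j, h, rfl⟩)
    · simp only [map_mul, map_inv, FreeGroup.lift_apply_of]
      exact mul_inv_eq_one.2 (hc _ _ h (by omega))
    · simp only [map_mul, map_inv, FreeGroup.lift_apply_of]
      rw [← h]
      exact mul_inv_eq_one.2 (hb _ (by omega)))

@[simp] theorem braidLift_sigma {G : Type} [Group G] (m : ℕ) (s : ℕ → G) (hc) (hb) {k : ℕ}
    (hk : k + 1 < m) : braidLift m s hc hb (sigma m k) = s k := by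
  unfold sigma braidLift
  rw [dif_pos (by omega)]
  simp

theorem braid_induction {m : ℕ} {p : BraidGroup m → Prop} (h1 : p 1)
    (hg : ∀ k, k + 1 < m → p (sigma m k)) (hm : ∀ a b, p a → p b → p (a * b))
    (hi : ∀ a, p a → p a⁻¹) (b : BraidGroup m) : p b := by
  have hb : b ∈ Subgroup.closure (Set.range (PresentedGroup.of (rels := braidRels m))) := by
    rw [PresentedGroup.closure_range_of]; trivial
  induction hb using Subgroup.closure_induction with
  | mem x hx =>
    obtain ⟨i, rfl⟩ := hx
    have := hg i (by omega)
    unfold sigma at this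
    rwa [dif_pos (by omega)] at this
  | one => exact h1
  | mul a b _ _ ha hb => exact hm a b ha hb
  | inv a _ ha => exact hi a ha

/-- The permutation of positions `0, …, m - 1` induced by a braid, as a permutation of `ℕ` fixing
everything else: `strandPerm m β j` is the top position of the strand of `β` whose bottom
position is `j`. -/
def strandPerm (m : ℕ) : BraidGroup m →* Equiv.Perm ℕ :=
  braidLift m (fun k => Equiv.swap k (k + 1))
    (by
      intro i j h _
      ext x
      simp only [Equiv.Perm.mul_apply, Equiv.swap_apply_def]
      split_ifs <;> omega)
    (by
      intro i _
      ext x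
      simp only [Equiv.Perm.mul_apply, Equiv.swap_apply_def]
      split_ifs <;> omega)

theorem strandPerm_sigma {m k : ℕ} (hk : k + 1 < m) (x : ℕ) :
    strandPerm m (sigma m k) x = if x = k then k + 1 else if x = k + 1 then k else x := by
  rw [strandPerm, braidLift_sigma _ _ _ _ hk, Equiv.swap_apply_def]

theorem strandPerm_lt {m : ℕ} (b : BraidGroup m) : ∀ x, strandPerm m b x < m ↔ x < m := by
  induction b using braid_induction with
  | h1 => simp
  | hg k hk => intro x; rw [strandPerm_sigma hk]; split_ifs <;> omega
  | hm a b ha hb => intro x; rw [map_mul, Equiv.Perm.mul_apply, ha, hb]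
  | hi a ha => intro x; rw [map_inv, ← ha]; simp

/-! ## Replacing one strand of a braid by parallel strands -/

/-- The braid `σ_s σ_{s+1} ⋯ σ_{s+b-1}`: the strand in position `s` passes over the next `b` strands. -/
def strandOver (m : ℕ) : ℕ → ℕ → BraidGroup m
  | 0, _ => 1
  | b + 1, s => strandOver m b s * sigma m (s + b)

/-- The braid `σ_{s+a-1} ⋯ σ_{s+1} σ_s`: the `a` strands in positions `s, …, s+a-1` pass, in
parallel, over the strand in position `s+a`. -/
def ribbonOver (m : ℕ) : ℕ → ℕ → BraidGroup m
  | 0, _ => 1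
  | a + 1, s => sigma m (s + a) * ribbonOver m a s

/-- Auxiliary group for the construction of cablings: pairs of a permutation and a family of group
elements, with the product of a wreath product. -/
@[ext] structure Wreath (G : Type) where
  perm : Equiv.Perm ℕ
  label : ℕ → G

namespace Wreath

variable {G : Type} [Group G]

instance : Mul (Wreath G) := ⟨fun a b => ⟨a.perm * b.perm, fun j => a.label (b.perm j) * b.label j⟩⟩
instance : One (Wreath G) := ⟨⟨1, fun _ => 1⟩⟩
instance : Inv (Wreath G) := ⟨fun a => ⟨a.perm⁻¹, fun j => (a.label (a.perm⁻¹ j))⁻¹⟩⟩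

@[simp] theorem mul_perm (a b : Wreath G) : (a * b).perm = a.perm * b.perm := rfl
@[simp] theorem mul_label (a b : Wreath G) (j : ℕ) :
    (a * b).label j = a.label (b.perm j) * b.label j := rfl
@[simp] theorem one_perm : (1 : Wreath G).perm = 1 := rfl
@[simp] theorem one_label (j : ℕ) : (1 : Wreath G).label j = 1 := rfl
@[simp] theorem inv_perm (a : Wreath G) : a⁻¹.perm = a.perm⁻¹ := rfl
@[simp] theorem inv_label (a : Wreath G) (j : ℕ) :
    a⁻¹.label j = (a.label (a.perm⁻¹ j))⁻¹ := rfl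

instance : Group (Wreath G) :=
  Group.ofLeftAxioms
    (by intro a b c; ext <;> simp [mul_assoc])
    (by intro a; ext <;> simp)
    (by intro a; ext <;> simp)

end Wreath

/-- The result of replacing, in the generator `σ_k` of the braid group on `m` strands, the strand
with bottom position `i` by `n` parallel strands. -/
def cableGen (n m i k : ℕ) : BraidGroup (m + n - 1) :=
  if i < k then sigma _ (k + n - 1)
  else if i = k then strandOver _ n k
  else if i = k + 1 then ribbonOver _ n k
  else sigma _ k

theorem sigma_comm2 (m : ℕ) {i j : ℕ} (h : i + 1 < j ∨ j + 1 < i) :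
    sigma m i * sigma m j = sigma m j * sigma m i := by
  rcases h with h | h
  · exact sigma_comm m h
  · exact (sigma_comm m h).symm

theorem strandOver_comm (m : ℕ) {b s t : ℕ} (h : t + 1 < s ∨ s + b < t) :
    strandOver m b s * sigma m t = sigma m t * strandOver m b s := by
  induction b with
  | zero => simp [strandOver]
  | succ b ih =>
    rw [strandOver, mul_assoc, sigma_comm2 m (by omega), ← mul_assoc, ih (by omega), mul_assoc]

theorem ribbonOver_comm (m : ℕ) {b s t : ℕ} (h : t + 1 < s ∨ s + b < t) :
    ribbonOver m b s * sigma m t = sigma m t * ribbonOver m b s := by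
  induction b with
  | zero => simp [ribbonOver]
  | succ b ih =>
    rw [ribbonOver, mul_assoc, ih (by omega), ← mul_assoc, sigma_comm2 m (by omega), mul_assoc]

theorem strandOver_comm' (m : ℕ) {b s c t : ℕ} (h : t + c < s ∨ s + b < t) :
    strandOver m b s * strandOver m c t = strandOver m c t * strandOver m b s := by
  induction c with
  | zero => simp [strandOver]
  | succ c ih =>
    rw [strandOver, ← mul_assoc, ih (by omega), mul_assoc, strandOver_comm m (by omega), mul_assoc]

theorem cable_rel_one (m n k : ℕ) (h : k + n + 1 < m) :
    sigma m k * strandOver m n (k + 1) * strandOver m n k =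
      strandOver m n (k + 1) * strandOver m n k * sigma m (k + n) := by
  induction n with
  | zero => simp [strandOver]
  | succ n ih =>
    have e1 : k + 1 + n = k + n + 1 := by omega
    have e2 : k + (n + 1) = k + n + 1 := by omega
    have key : strandOver m (n + 1) (k + 1) * strandOver m (n + 1) k =
        (strandOver m n (k + 1) * strandOver m n k) * (sigma m (k + n + 1) * sigma m (k + n)) := by
      simp only [strandOver, e1]
      simp only [mul_assoc]
      rw [← mul_assoc (sigma m (k + n + 1)), ← strandOver_comm m (by omega), mul_assoc]
    have ih' := ih (by omega)
    rw [mul_assoc, key, ← mul_assoc (sigma m k), ← mul_assoc (sigma m k), ih', e2]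
    simp only [mul_assoc]
    rw [← mul_assoc (sigma m (k + n)), sigma_braid m (by omega), mul_assoc]

theorem cable_rel_two (m n k : ℕ) (h : k + n + 1 < m) :
    strandOver m n k * sigma m (k + n) * ribbonOver m n k =
      ribbonOver m n (k + 1) * sigma m k * strandOver m n (k + 1) := by
  induction n with
  | zero => simp [strandOver, ribbonOver]
  | succ n ih =>
    have e1 : k + 1 + n = k + n + 1 := by omega
    have e2 : k + (n + 1) = k + n + 1 := by omega
    simp only [strandOver, ribbonOver, e1, e2]
    calc strandOver m n k * sigma m (k + n) * sigma m (k + n + 1) * (sigma m (k + n) * ribbonOver m n k)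
        = strandOver m n k * (sigma m (k + n) * sigma m (k + n + 1) * sigma m (k + n)) * ribbonOver m n k := by
          simp only [mul_assoc]
      _ = (strandOver m n k * sigma m (k + n + 1)) * sigma m (k + n) *
            (sigma m (k + n + 1) * ribbonOver m n k) := by
          rw [sigma_braid m (by omega)]; simp only [mul_assoc]
      _ = sigma m (k + n + 1) * (strandOver m n k * sigma m (k + n) * ribbonOver m n k) *
            sigma m (k + n + 1) := by
          rw [strandOver_comm m (by omega), ← ribbonOver_comm m (by omega)]; simp only [mul_assoc]
      _ = _ := by rw [ih (by omega)]; simp only [mul_assoc]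

theorem cable_rel_three (m n k : ℕ) (h : k + n + 1 < m) :
    ribbonOver m n k * ribbonOver m n (k + 1) * sigma m k =
      sigma m (k + n) * ribbonOver m n k * ribbonOver m n (k + 1) := by
  induction n with
  | zero => simp [ribbonOver]
  | succ n ih =>
    have e1 : k + 1 + n = k + n + 1 := by omega
    have e2 : k + (n + 1) = k + n + 1 := by omega
    have key : ribbonOver m (n + 1) k * ribbonOver m (n + 1) (k + 1) =
        (sigma m (k + n) * sigma m (k + n + 1)) * (ribbonOver m n k * ribbonOver m n (k + 1)) := by
      simp only [ribbonOver, e1]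
      simp only [mul_assoc]
      rw [← mul_assoc (ribbonOver m n k), ribbonOver_comm m (by omega), mul_assoc]
    rw [mul_assoc (sigma m _), key, mul_assoc _ _ (sigma m k), ih (by omega), e2]
    simp only [← mul_assoc]
    rw [sigma_braid m (by omega)]

theorem cableGen_lt {n m i k : ℕ} (h : i < k) : cableGen n m i k = sigma _ (k + n - 1) := by
  simp [cableGen, h]

theorem cableGen_self {n m k : ℕ} : cableGen n m k k = strandOver _ n k := by
  simp [cableGen]

theorem cableGen_succ {n m k : ℕ} : cableGen n m (k + 1) k = ribbonOver _ n k := by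
  simp [cableGen]

theorem cableGen_gt {n m i k : ℕ} (h : k + 1 < i) : cableGen n m i k = sigma _ k := by
  rw [cableGen, if_neg (by omega), if_neg (by omega), if_neg (by omega)]

theorem swap_other {k x : ℕ} (h : x < k ∨ k + 1 < x) : Equiv.swap k (k + 1) x = x :=
  Equiv.swap_apply_of_ne_of_ne (by omega) (by omega)

/-- The homomorphism that encodes the cablings of all strands simultaneously. -/
def cableHom (n m : ℕ) [hn : n.AtLeastTwo] : BraidGroup m →* Wreath (BraidGroup (m + n - 1)) :=
  braidLift m (fun k => ⟨Equiv.swap k (k + 1), fun i => cableGen n m i k⟩)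
    (by
      have hn := hn.prop
      intro i j h hj
      ext x
      · simp only [Wreath.mul_perm, Equiv.Perm.mul_apply, Equiv.swap_apply_def]
        split_ifs <;> omega
      · simp only [Wreath.mul_label]
        rcases (by omega : x < i ∨ x = i ∨ x = i + 1 ∨ (i + 1 < x ∧ x < j) ∨ x = j ∨ x = j + 1 ∨
          j + 1 < x) with h | rfl | rfl | h | rfl | rfl | h
        · rw [swap_other (by omega), swap_other (by omega), cableGen_lt h, cableGen_lt (by omega)]
          exact sigma_comm2 _ (by omega)
        · rw [swap_other (by omega), Equiv.swap_apply_left, cableGen_self, cableGen_lt (by omega),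
            cableGen_lt (by omega)]
          exact strandOver_comm _ (by omega)
        · rw [swap_other (by omega), Equiv.swap_apply_right, cableGen_succ, cableGen_lt (by omega),
            cableGen_lt (by omega)]
          exact ribbonOver_comm _ (by omega)
        · rw [swap_other (by omega), swap_other (by omega), cableGen_gt (by omega),
            cableGen_lt (by omega)]
          exact sigma_comm2 _ (by omega)
        · rw [swap_other (k := i) (by omega), Equiv.swap_apply_left, cableGen_self,
            cableGen_gt (by omega), cableGen_gt (by omega)]
          exact (strandOver_comm _ (by omega)).symm
        · rw [swap_other (k := i) (by omega), Equiv.swap_apply_right, cableGen_succ,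
            cableGen_gt (by omega), cableGen_gt (by omega)]
          exact (ribbonOver_comm _ (by omega)).symm
        · rw [swap_other (by omega), swap_other (by omega), cableGen_gt (by omega),
            cableGen_gt (by omega)]
          exact sigma_comm2 _ (by omega))
    (by
      have hn := hn.prop
      intro k hk
      ext x
      · simp only [Wreath.mul_perm, Equiv.Perm.mul_apply, Equiv.swap_apply_def]
        split_ifs <;> omega
      · simp only [Wreath.mul_label]
        have e : k + 1 + n - 1 = k + n := by omega
        have e2 : k + n = (k + n - 1) + 1 := by omega
        rcases (by omega : x < k ∨ x = k ∨ x = k + 1 ∨ x = k + 1 + 1 ∨ k + 1 + 1 < x)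
          with h | rfl | rfl | rfl | h
        · rw [swap_other (k := k) (by omega), swap_other (k := k + 1) (by omega),
            swap_other (k := k) (by omega), cableGen_lt h, cableGen_lt (by omega), e, e2]
          exact sigma_braid _ (by omega)
        · rw [swap_other (k := x + 1) (x := x) (by omega), Equiv.swap_apply_left,
            Equiv.swap_apply_left, cableGen_gt (k := x) (by omega), cableGen_self, cableGen_self,
            cableGen_lt (by omega), e]
          exact cable_rel_one _ _ _ (by omega)
        · rw [Equiv.swap_apply_right, swap_other (k := k + 1) (x := k) (by omega),
            Equiv.swap_apply_left (k + 1), swap_other (k := k) (x := k + 1 + 1) (by omega),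
            cableGen_succ, cableGen_self, cableGen_lt (by omega), cableGen_succ, cableGen_self,
            cableGen_gt (by omega), e]
          exact cable_rel_two _ _ _ (by omega)
        · rw [swap_other (k := k) (x := k + 1 + 1) (by omega), Equiv.swap_apply_right,
            Equiv.swap_apply_right, cableGen_gt (i := k + 1 + 1) (k := k) (by omega), cableGen_succ,
            cableGen_succ, cableGen_lt (k := k + 1) (by omega), e]
          exact cable_rel_three _ _ _ (by omega)
        · rw [swap_other (k := k) (x := x) (by omega), swap_other (k := k + 1) (x := x) (by omega),
            swap_other (k := k) (x := x) (by omega), cableGen_gt (k := k) (by omega),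
            cableGen_gt h]
          exact sigma_braid _ (by omega))

theorem cableHom_perm (n m : ℕ) [n.AtLeastTwo] (b : BraidGroup m) :
    (cableHom n m b).perm = strandPerm m b := by
  induction b using braid_induction with
  | h1 => simp
  | hg k hk =>
    rw [cableHom, braidLift_sigma _ _ _ _ hk, strandPerm, braidLift_sigma _ _ _ _ hk]
  | hm a b ha hb => rw [map_mul, map_mul, Wreath.mul_perm, ha, hb]
  | hi a ha => rw [map_inv, map_inv, Wreath.inv_perm, ha]

/-- `cable n m i b`: the braid on `m + n - 1` strands obtained from the braid `b` on `m` strands by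
replacing the strand with bottom position `i` by `n` parallel strands. -/
def cable (n m : ℕ) [n.AtLeastTwo] (i : ℕ) (b : BraidGroup m) : BraidGroup (m + n - 1) :=
  (cableHom n m b).label i

section cable

variable {n m : ℕ} [hn : n.AtLeastTwo]

theorem cable_one (i : ℕ) : cable n m i 1 = 1 := by simp [cable]

theorem cable_mul (i : ℕ) (a b : BraidGroup m) :
    cable n m i (a * b) = cable n m (strandPerm m b i) a * cable n m i b := by
  simp [cable, cableHom_perm]

theorem cable_sigma (i : ℕ) {k : ℕ} (hk : k + 1 < m) :
    cable n m i (sigma m k) = cableGen n m i k := by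
  rw [cable, cableHom, braidLift_sigma _ _ _ _ hk]

theorem cable_inv (i : ℕ) (a : BraidGroup m) :
    cable n m i a⁻¹ = (cable n m ((strandPerm m a)⁻¹ i) a)⁻¹ := by
  simp [cable, cableHom_perm]

/-! ### Permutations of cablings -/

theorem strandPerm_strandOver {m b s : ℕ} (h : s + b < m) (x : ℕ) :
    strandPerm m (strandOver m b s) x =
      if x < s then x else if x < s + b then x + 1 else if x = s + b then s else x := by
  induction b generalizing x with
  | zero =>
    simp only [strandOver, map_one, Equiv.Perm.one_apply]
    split_ifs <;> omega
  | succ b ih =>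
    rw [strandOver, map_mul, Equiv.Perm.mul_apply, strandPerm_sigma (by omega), ih (by omega)]
    split_ifs <;> omega

theorem strandPerm_ribbonOver {m b s : ℕ} (h : s + b < m) (x : ℕ) :
    strandPerm m (ribbonOver m b s) x =
      if x < s then x else if x = s then s + b else if x ≤ s + b then x - 1 else x := by
  induction b generalizing x with
  | zero =>
    simp only [ribbonOver, map_one, Equiv.Perm.one_apply]
    split_ifs <;> omega
  | succ b ih =>
    rw [ribbonOver, map_mul, Equiv.Perm.mul_apply, ih (by omega), strandPerm_sigma (by omega)]
    split_ifs <;> omega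

/-- The new position of the strand in position `i ≠ j` when the strand in position `j` is replaced
by `n` strands. -/
def shift (n j i : ℕ) : ℕ := if i < j then i else i + n - 1

theorem strandPerm_cableGen_block {k : ℕ} (hk : k + 1 < m) (j t : ℕ) (ht : t < n) :
    strandPerm _ (cableGen n m j k) (j + t) = strandPerm m (sigma m k) j + t := by
  have := hn.prop
  rw [strandPerm_sigma hk]
  unfold cableGen
  split_ifs <;> first
    | omega
    | (rw [strandPerm_sigma (by omega)]; split_ifs <;> omega)
    | (rw [strandPerm_strandOver (by omega)]; split_ifs <;> omega)
    | (rw [strandPerm_ribbonOver (by omega)]; split_ifs <;> omega)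

theorem strandPerm_cableGen_shift {k : ℕ} (hk : k + 1 < m) (j i : ℕ) (h : i ≠ j) :
    strandPerm _ (cableGen n m j k) (shift n j i) =
      shift n (strandPerm m (sigma m k) j) (strandPerm m (sigma m k) i) := by
  have := hn.prop
  rw [strandPerm_sigma hk, strandPerm_sigma hk]
  unfold cableGen shift
  split_ifs <;> first
    | omega
    | (rw [strandPerm_sigma (by omega)]; split_ifs <;> omega)
    | (rw [strandPerm_strandOver (by omega)]; split_ifs <;> omega)
    | (rw [strandPerm_ribbonOver (by omega)]; split_ifs <;> omega)

theorem strandPerm_cable (b : BraidGroup m) : ∀ j,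
    (∀ t, t < n → strandPerm _ (cable n m j b) (j + t) = strandPerm m b j + t) ∧
    ∀ i, i ≠ j → strandPerm _ (cable n m j b) (shift n j i) =
      shift n (strandPerm m b j) (strandPerm m b i) := by
  induction b using braid_induction with
  | h1 => intro j; simp [cable_one]
  | hg k hk =>
    intro j
    rw [cable_sigma _ hk]
    exact ⟨fun t ht => strandPerm_cableGen_block hk j t ht,
      fun i h => strandPerm_cableGen_shift hk j i h⟩
  | hm a b ha hb =>
    intro j
    rw [cable_mul]
    refine ⟨fun t ht => ?_, fun i h => ?_⟩
    · rw [map_mul, map_mul, Equiv.Perm.mul_apply, Equiv.Perm.mul_apply, (hb j).1 t ht,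
        (ha _).1 t ht]
    · rw [map_mul, map_mul, Equiv.Perm.mul_apply, Equiv.Perm.mul_apply, (hb j).2 i h,
        (ha _).2 _ (by simpa using h)]
      rfl
  | hi a ha =>
    intro j
    rw [cable_inv]
    refine ⟨fun t ht => ?_, fun i h => ?_⟩
    · have := (ha ((strandPerm m a)⁻¹ j)).1 t ht
      rw [map_inv, map_inv, Equiv.Perm.inv_eq_iff_eq, this]
      simp
    · have := (ha ((strandPerm m a)⁻¹ j)).2 ((strandPerm m a)⁻¹ i) (by simpa using h)
      rw [map_inv, map_inv, Equiv.Perm.inv_eq_iff_eq, this]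
      simp

end cable

theorem perm_apply_inv (p : Equiv.Perm ℕ) (x : ℕ) : p (p⁻¹ x) = x := by simp

theorem perm_inv_apply (p : Equiv.Perm ℕ) (x : ℕ) : p⁻¹ (p x) = x := by simp

/-! ### Inserting a braid on `n` neighbouring strands -/

/-- `insertBraid n m i h` is the braid `h` on `n` strands, placed on the strands in positions
`i, …, i + n - 1` of the trivial braid on `m + n - 1` strands (for `i < m`). -/
def insertBraid (n m i : ℕ) : BraidGroup n →* BraidGroup (m + n - 1) :=
  if hi : i < m then
    braidLift n (fun k => sigma _ (i + k))
      (fun a b h _ => sigma_comm _ (by omega))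
      (fun a _ => sigma_braid _ (by omega))
  else 1

theorem insertBraid_sigma {n m i k : ℕ} (hi : i < m) (hk : k + 1 < n) :
    insertBraid n m i (sigma n k) = sigma _ (i + k) := by
  rw [insertBraid, dif_pos hi, braidLift_sigma _ _ _ _ hk]

theorem strandPerm_insertBraid {n m i : ℕ} (hi : i < m) (h : BraidGroup n) :
    ∀ x, (x < i ∨ i + n ≤ x → strandPerm _ (insertBraid n m i h) x = x) ∧
      (i ≤ x ∧ x < i + n → i ≤ strandPerm _ (insertBraid n m i h) x ∧
        strandPerm _ (insertBraid n m i h) x < i + n) := by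
  induction h using braid_induction with
  | h1 => intro x; simp
  | hg k hk =>
    intro x
    rw [insertBraid_sigma hi hk, strandPerm_sigma (by omega)]
    constructor <;> intro hx <;> split_ifs <;> omega
  | hm a b ha hb =>
    intro x
    simp only [map_mul, Equiv.Perm.mul_apply]
    constructor
    · intro hx; rw [(hb x).1 hx, (ha x).1 hx]
    · intro hx; exact (ha _).2 ((hb x).2 hx)
  | hi a ha =>
    intro x
    simp only [map_inv]
    set p := strandPerm _ (insertBraid n m i a) with hp
    have hx : p (p⁻¹ x) = x := by simp
    have h2 := ha (p⁻¹ x)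
    rw [hx] at h2
    have h3 := ha x
    constructor
    · intro h
      rw [Equiv.Perm.inv_eq_iff_eq, h3.1 h]
    · intro h
      by_contra hc
      have := h2.1 (by omega)
      omega

theorem sigma_strandOver {m n s t : ℕ} (h : s + n < m) (ht : t + 1 < n) :
    sigma m (s + t + 1) * strandOver m n s = strandOver m n s * sigma m (s + t) := by
  induction n with
  | zero => omega
  | succ n ih =>
    rcases (by omega : t + 1 < n ∨ t + 1 = n) with h1 | rfl
    · rw [strandOver, ← mul_assoc, ih (by omega) h1, mul_assoc, mul_assoc,
        sigma_comm _ (by omega)]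
    · simp only [strandOver]
      rw [← add_assoc s t 1]
      rw [← mul_assoc, ← mul_assoc, ← strandOver_comm _ (by omega)]
      simp only [mul_assoc]
      congr 1
      simp only [← mul_assoc]
      exact (sigma_braid _ (by omega)).symm

theorem sigma_ribbonOver {m n s t : ℕ} (h : s + n < m) (ht : t + 1 < n) :
    sigma m (s + t) * ribbonOver m n s = ribbonOver m n s * sigma m (s + t + 1) := by
  induction n with
  | zero => omega
  | succ n ih =>
    rcases (by omega : t + 1 < n ∨ t + 1 = n) with h1 | rfl
    · rw [ribbonOver, mul_assoc, ← ih (by omega) h1, ← mul_assoc, ← mul_assoc,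
        sigma_comm _ (by omega)]
    · simp only [ribbonOver]
      rw [← add_assoc s t 1]
      simp only [mul_assoc]
      rw [ribbonOver_comm _ (by omega)]
      simp only [← mul_assoc]
      congr 1
      exact sigma_braid _ (by omega)

section cable

variable {n m : ℕ} [hn : n.AtLeastTwo]

theorem insertBraid_cableGen {i k : ℕ} (hi : i < m) (hk : k + 1 < m) (h : BraidGroup n) :
    insertBraid n m (strandPerm m (sigma m k) i) h * cableGen n m i k =
      cableGen n m i k * insertBraid n m i h := by
  have hn := hn.prop
  have hi' : strandPerm m (sigma m k) i < m := (strandPerm_lt _ _).2 hi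
  induction h using braid_induction with
  | h1 => simp
  | hg t ht =>
    rw [insertBraid_sigma hi ht, insertBraid_sigma hi' ht, strandPerm_sigma hk]
    rcases (by omega : i < k ∨ i = k ∨ i = k + 1 ∨ k + 1 < i) with h | rfl | rfl | h
    · rw [if_neg (by omega), if_neg (by omega), cableGen_lt h, sigma_comm2 _ (by omega)]
    · rw [if_pos rfl, cableGen_self, show i + 1 + t = i + t + 1 by omega]
      exact sigma_strandOver (by omega) ht
    · rw [if_neg (by omega), if_pos rfl, cableGen_succ, show k + 1 + t = k + t + 1 by omega]
      exact sigma_ribbonOver (by omega) ht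
    · rw [if_neg (by omega), if_neg (by omega), cableGen_gt h, sigma_comm2 _ (by omega)]
  | hm a b ha hb => rw [map_mul, map_mul, mul_assoc, hb, ← mul_assoc, ha, mul_assoc]
  | hi a ha => rw [map_inv, map_inv, inv_mul_eq_iff_eq_mul, ← mul_assoc, ha, mul_inv_cancel_right]

theorem insertBraid_cable (b : BraidGroup m) (h : BraidGroup n) : ∀ i, i < m →
    insertBraid n m (strandPerm m b i) h * cable n m i b =
      cable n m i b * insertBraid n m i h := by
  induction b using braid_induction with
  | h1 => intro i _; simp [cable_one]
  | hg k hk => intro i hi; rw [cable_sigma _ hk]; exact insertBraid_cableGen hi hk h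
  | hm a b ha hb =>
    intro i hi
    rw [cable_mul, map_mul, Equiv.Perm.mul_apply, ← mul_assoc,
      ha _ ((strandPerm_lt _ _).2 hi), mul_assoc, hb _ hi, mul_assoc]
  | hi a ha =>
    intro i hi
    have hi' : (strandPerm m a)⁻¹ i < m := by
      rw [← strandPerm_lt a]; simpa using hi
    have := ha _ hi'
    rw [cable_inv, map_inv, eq_inv_mul_iff_mul_eq, ← mul_assoc, ← this]
    simp

/-! ### Cablings of different strands commute -/

/-- The `a` strands in positions `s, …, s+a-1` pass over the next `b` strands. -/
def ribbonCross (m : ℕ) (a : ℕ) : ℕ → ℕ → BraidGroup m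
  | 0, _ => 1
  | b + 1, s => ribbonCross m a b s * ribbonOver m a (s + b)

theorem ribbonCross_comm (m : ℕ) {a b s t : ℕ} (h : s + a + b ≤ t) :
    ribbonCross m a b s * sigma m t = sigma m t * ribbonCross m a b s := by
  induction b with
  | zero => simp [ribbonCross]
  | succ b ih =>
    rw [ribbonCross, mul_assoc, ribbonOver_comm m (by omega), ← mul_assoc, ih (by omega),
      mul_assoc]

theorem ribbonCross_zero (m b s : ℕ) : ribbonCross m 0 b s = 1 := by
  induction b with
  | zero => rfl
  | succ b ih => rw [ribbonCross, ih]; simp [ribbonOver]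

theorem ribbonCross_succ (m a b s : ℕ) :
    ribbonCross m (a + 1) b s = strandOver m b (s + a) * ribbonCross m a b s := by
  induction b with
  | zero => simp [ribbonCross, strandOver]
  | succ b ih =>
    rw [ribbonCross, ih, strandOver, ribbonOver, ribbonCross]
    rw [show s + b + a = s + a + b by omega]
    simp only [mul_assoc]
    rw [← mul_assoc (ribbonCross _ _ _ _), ribbonCross_comm m (by omega), mul_assoc]

theorem strandOver_mul (m a b s : ℕ) :
    strandOver m a s * strandOver m b (s + a) = strandOver m (a + b) s := by
  induction b with
  | zero => simp [strandOver]
  | succ b ih =>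
    rw [strandOver, ← mul_assoc, ih, ← add_assoc a b 1, strandOver, add_assoc s a b]

theorem ribbonOver_mul (m a b s : ℕ) :
    ribbonOver m b (s + a) * ribbonOver m a s = ribbonOver m (a + b) s := by
  induction b with
  | zero => simp [ribbonOver]
  | succ b ih =>
    rw [ribbonOver, mul_assoc, ih, ← add_assoc a b 1, ribbonOver, add_assoc s a b]

theorem cable_strandOver {b s : ℕ} (h : s + b < m) (i : ℕ) :
    cable n m i (strandOver m b s) =
      if i < s then strandOver _ b (s + n - 1)
      else if i < s + b then strandOver _ (b + n - 1) s
      else if i = s + b then ribbonCross _ n b s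
      else strandOver _ b s := by
  have hn := hn.prop
  induction b generalizing i with
  | zero =>
    rw [strandOver, cable_one]
    split_ifs <;> first | rfl | omega
  | succ b ih =>
    have hsb : s + b + 1 < m := by omega
    have hp := strandPerm_sigma hsb i
    rw [strandOver, cable_mul, cable_sigma _ hsb, ih (by omega)]
    rcases (by omega : i < s ∨ (s ≤ i ∧ i < s + b) ∨ i = s + b ∨ i = s + b + 1 ∨ s + b + 1 < i)
      with h1 | h1 | rfl | rfl | h1
    · rw [if_neg (by omega), if_neg (by omega)] at hp
      rw [hp, if_pos h1, if_pos h1, cableGen_lt (by omega),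
        strandOver, show s + n - 1 + b = s + b + n - 1 by omega]
    · rw [if_neg (by omega), if_neg (by omega)] at hp
      rw [hp, if_neg (by omega), if_pos (by omega),
        if_neg (by omega), if_pos (by omega), cableGen_lt (by omega),
        show b + 1 + n - 1 = (b + n - 1) + 1 by omega, strandOver,
        show s + (b + n - 1) = s + b + n - 1 by omega]
    · rw [if_pos rfl] at hp
      rw [hp, if_neg (by omega), if_neg (by omega), if_neg (by omega), if_neg (by omega),
        if_pos (by omega), cableGen_self, strandOver_mul, show b + 1 + n - 1 = b + n by omega]
    · rw [if_neg (by omega), if_pos rfl] at hp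
      rw [hp, if_neg (by omega), if_neg (by omega), if_pos rfl,
        if_neg (by omega), if_neg (by omega), if_pos (by omega), cableGen_succ, ribbonCross]
    · rw [if_neg (by omega), if_neg (by omega)] at hp
      rw [hp, if_neg (by omega), if_neg (by omega),
        if_neg (by omega), if_neg (by omega), if_neg (by omega), if_neg (by omega),
        cableGen_gt (by omega), strandOver]

theorem cable_ribbonOver {b s : ℕ} (h : s + b < m) (i : ℕ) :
    cable n m i (ribbonOver m b s) =
      if i < s then ribbonOver _ b (s + n - 1)
      else if i = s then ribbonCross _ b n s
      else if i ≤ s + b then ribbonOver _ (b + n - 1) s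
      else ribbonOver _ b s := by
  have hn := hn.prop
  induction b generalizing i with
  | zero =>
    rw [ribbonOver, cable_one]
    split_ifs <;> first | rfl | omega | exact (ribbonCross_zero _ _ _).symm
  | succ b ih =>
    have hsb : s + b + 1 < m := by omega
    have hp := strandPerm_ribbonOver (b := b) (s := s) (m := m) (by omega) i
    rw [ribbonOver, cable_mul, cable_sigma _ hsb, ih (by omega)]
    rcases (by omega : i < s ∨ i = s ∨ (s < i ∧ i ≤ s + b) ∨ i = s + b + 1 ∨ s + b + 1 < i)
      with h1 | rfl | h1 | rfl | h1
    · rw [if_pos h1] at hp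
      rw [hp, if_pos h1, if_pos h1, cableGen_lt (by omega),
        ribbonOver, show s + n - 1 + b = s + b + n - 1 by omega]
    · rw [if_neg (by omega), if_pos rfl] at hp
      rw [hp, if_neg (by omega), if_pos rfl, if_neg (by omega),
        if_pos rfl, cableGen_self, ribbonCross_succ]
    · rw [if_neg (by omega), if_neg (by omega), if_pos (by omega)] at hp
      rw [hp, if_neg (by omega), if_neg (by omega), if_pos (by omega), if_neg (by omega),
        if_neg (by omega), if_pos (by omega), cableGen_lt (by omega),
        show b + 1 + n - 1 = (b + n - 1) + 1 by omega, ribbonOver,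
        show s + (b + n - 1) = s + b + n - 1 by omega]
    · rw [if_neg (by omega), if_neg (by omega), if_neg (by omega)] at hp
      rw [hp, if_neg (by omega), if_neg (by omega), if_neg (by omega), if_neg (by omega),
        if_neg (by omega), if_pos (by omega), cableGen_succ, ribbonOver_mul,
        show b + 1 + n - 1 = b + n by omega]
    · rw [if_neg (by omega), if_neg (by omega), if_neg (by omega)] at hp
      rw [hp, if_neg (by omega), if_neg (by omega), if_neg (by omega), if_neg (by omega),
        if_neg (by omega), if_neg (by omega), cableGen_gt (by omega), ribbonOver]

theorem cable_cableGen {i j k : ℕ} (hk : k + 1 < m) (hij : i < j) :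
    cable n _ i (cableGen n m j k) = cable n _ (j + n - 1) (cableGen n m i k) := by
  have hn := hn.prop
  rcases (by omega : j < k ∨ j = k ∨ j = k + 1 ∨ k + 1 < j) with h | rfl | rfl | h
  · rw [cableGen_lt h, cableGen_lt (by omega), cable_sigma _ (by omega), cable_sigma _ (by omega),
      cableGen_lt (by omega), cableGen_lt (by omega)]
  · rw [cableGen_self, cableGen_lt hij, cable_strandOver (by omega), cable_sigma _ (by omega),
      if_pos hij, cableGen_self]
  · rw [cableGen_succ, cable_ribbonOver (by omega), show k + 1 + n - 1 = k + n by omega]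
    rcases (by omega : i < k ∨ i = k) with h | rfl
    · have e := cableGen_succ (n := n) (m := m + n - 1) (k := k + n - 1)
      rw [show k + n - 1 + 1 = k + n by omega] at e
      rw [if_pos h, cableGen_lt h, cable_sigma _ (by omega), e]
    · rw [if_neg (by omega), if_pos rfl, cableGen_self, cable_strandOver (by omega),
        if_neg (by omega), if_neg (by omega), if_pos rfl]
  · rw [cableGen_gt h, cable_sigma _ (by omega)]
    rcases (by omega : i < k ∨ i = k ∨ i = k + 1 ∨ k + 1 < i) with h | rfl | rfl | h
    · rw [cableGen_lt h, cableGen_lt h, cable_sigma _ (by omega), cableGen_gt (by omega)]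
    · rw [cableGen_self, cableGen_self, cable_strandOver (by omega), if_neg (by omega),
        if_neg (by omega), if_neg (by omega)]
    · rw [cableGen_succ, cableGen_succ, cable_ribbonOver (by omega), if_neg (by omega),
        if_neg (by omega), if_neg (by omega)]
    · rw [cableGen_gt h, cableGen_gt h, cable_sigma _ (by omega), cableGen_gt (by omega)]

theorem cable_cable (b : BraidGroup m) : ∀ i j, i ≠ j →
    cable n _ (shift n j i) (cable n m j b) = cable n _ (shift n i j) (cable n m i b) := by
  induction b using braid_induction with
  | h1 => intro i j _; simp [cable_one]
  | hg k hk =>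
    intro i j h
    rw [cable_sigma _ hk, cable_sigma _ hk]
    unfold shift
    rcases Nat.lt_or_gt_of_ne h with h | h
    · rw [if_pos h, if_neg (by omega)]; exact cable_cableGen hk h
    · rw [if_neg (by omega), if_pos h]; exact (cable_cableGen hk h).symm
  | hm a b ha hb =>
    intro i j h
    rw [cable_mul, cable_mul, cable_mul, cable_mul, hb i j h, (strandPerm_cable b j).2 i h,
      (strandPerm_cable b i).2 j h.symm, ha _ _ (by simpa using h)]
  | hi a ha =>
    intro i j h
    have h' : (strandPerm m a)⁻¹ i ≠ (strandPerm m a)⁻¹ j := by simpa using h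
    have e1 := (strandPerm_cable (n := n) a ((strandPerm m a)⁻¹ j)).2 _ h'
    have e2 := (strandPerm_cable (n := n) a ((strandPerm m a)⁻¹ i)).2 _ h'.symm
    rw [perm_apply_inv, perm_apply_inv] at e1 e2
    rw [cable_inv, cable_inv, cable_inv, cable_inv, ← e1, ← e2, perm_inv_apply,
      perm_inv_apply, ha _ _ h']

theorem cable_insertBraid {i j : ℕ} (hi : i < m) (h : i ≠ j) (a : BraidGroup n) :
    cable n _ (shift n i j) (insertBraid n m i a) = insertBraid n _ (shift n j i) a := by
  have hn := hn.prop
  have hm : shift n j i < m + n - 1 := by unfold shift; split_ifs <;> omega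
  have hp : ∀ a, strandPerm _ (insertBraid n m i a) (shift n i j) = shift n i j := by
    intro a
    refine (strandPerm_insertBraid hi a _).1 ?_
    unfold shift; split_ifs <;> omega
  induction a using braid_induction with
  | h1 => simp [cable_one]
  | hg k hk =>
    rw [insertBraid_sigma hi hk, insertBraid_sigma hm hk, cable_sigma _ (by omega)]
    unfold shift
    split_ifs
    · omega
    · rw [cableGen_lt (by omega), show i + n - 1 + k = i + k + n - 1 by omega]
    · rw [cableGen_gt (by omega)]
    · omega
  | hm a b ha hb => rw [map_mul, map_mul, cable_mul, hp, ha, hb]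
  | hi a ha =>
    rw [map_inv, map_inv, cable_inv, ← ha]
    rw [show (strandPerm _ (insertBraid n m i a))⁻¹ (shift n i j) = shift n i j from by
      rw [Equiv.Perm.inv_eq_iff_eq, hp]]

end cable

theorem insertBraid_comm {n m i j : ℕ} (hi : i < m) (hj : j < m) (h : i + n ≤ j)
    (a b : BraidGroup n) :
    insertBraid n m i a * insertBraid n m j b = insertBraid n m j b * insertBraid n m i a := by
  have key : ∀ k, k + 1 < n → ∀ a,
      Commute (insertBraid n m i a) (insertBraid n m j (sigma n k)) := by
    intro k hk a
    induction a using braid_induction with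
    | h1 => simp
    | hg l hl =>
      rw [insertBraid_sigma hi hl, insertBraid_sigma hj hk]
      exact sigma_comm _ (by omega)
    | hm a b ha hb => rw [map_mul]; exact ha.mul_left hb
    | hi a ha => rw [map_inv]; exact ha.inv_left
  change Commute _ _
  induction b using braid_induction with
  | h1 => simp
  | hg l hl => exact key l hl a
  | hm a b ha hb => rw [map_mul]; exact ha.mul_right hb
  | hi a ha => rw [map_inv]; exact ha.inv_right

/-! ## Labelled braids -/

/-- A braid on `m` strands, each strand of which carries a label in the subgroup `H` of the braid
group on `n` strands. Strands are numbered `0, …, m - 1` by their bottom positions; `label j` is the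
label of the strand with bottom position `j` and is set to `1` for `j ≥ m`. -/
@[ext] structure LabelledBraid (n m : ℕ) (H : Subgroup (BraidGroup n)) where
  braid : BraidGroup m
  label : ℕ → H
  label_eq_one : ∀ j, m ≤ j → label j = 1

namespace LabelledBraid

variable {n m : ℕ} {H : Subgroup (BraidGroup n)}

/-- Composition from top to bottom: braids are composed, and the labels met along a strand are
multiplied. -/
instance : Mul (LabelledBraid n m H) :=
  ⟨fun g g' => ⟨g.braid * g'.braid, fun j => g.label (strandPerm m g'.braid j) * g'.label j, by
    intro j hj
    have : m ≤ strandPerm m g'.braid j := by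
      rw [← not_lt, strandPerm_lt, not_lt]; exact hj
    rw [g.label_eq_one _ this, g'.label_eq_one _ hj, one_mul]⟩⟩

instance : One (LabelledBraid n m H) := ⟨⟨1, fun _ => 1, fun _ _ => rfl⟩⟩

instance : Inv (LabelledBraid n m H) :=
  ⟨fun g => ⟨g.braid⁻¹, fun j => (g.label (strandPerm m g.braid⁻¹ j))⁻¹, by
    intro j hj
    have : m ≤ strandPerm m g.braid⁻¹ j := by
      rw [← not_lt, strandPerm_lt, not_lt]; exact hj
    rw [g.label_eq_one _ this, inv_one]⟩⟩

@[simp] theorem mul_braid (a b : LabelledBraid n m H) : (a * b).braid = a.braid * b.braid := rfl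
@[simp] theorem mul_label (a b : LabelledBraid n m H) (j : ℕ) :
    (a * b).label j = a.label (strandPerm m b.braid j) * b.label j := rfl
@[simp] theorem one_braid : (1 : LabelledBraid n m H).braid = 1 := rfl
@[simp] theorem one_label (j : ℕ) : (1 : LabelledBraid n m H).label j = 1 := rfl
@[simp] theorem inv_braid (a : LabelledBraid n m H) : a⁻¹.braid = a.braid⁻¹ := rfl
@[simp] theorem inv_label (a : LabelledBraid n m H) (j : ℕ) :
    a⁻¹.label j = (a.label (strandPerm m a.braid⁻¹ j))⁻¹ := rfl

theorem ext_of {a b : LabelledBraid n m H} (h1 : a.braid = b.braid)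
    (h2 : ∀ j, a.label j = b.label j) : a = b :=
  LabelledBraid.ext h1 (funext h2)

instance : Group (LabelledBraid n m H) :=
  Group.ofLeftAxioms
    (by intro a b c; exact ext_of (by simp [mul_assoc]) (by intro j; simp [mul_assoc]))
    (by intro a; exact ext_of (by simp) (by intro j; simp))
    (by
      intro a
      refine ext_of (by simp) (fun j => ?_)
      simp only [mul_label, inv_label, one_label, map_inv, perm_inv_apply, inv_mul_cancel])

/-- The labels after replacing strand `i` by `n` strands, all carrying the label of `i`. -/
def splitLabel (n : ℕ) {K : Type} (label : ℕ → K) (i j : ℕ) : K :=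
  if j < i then label j else if j < i + n then label i else label (j + 1 - n)

/-- The expansion of a labelled braid at the strand with bottom position `i < m`: if `h` is the
label of that strand, then the strand is replaced by `n` parallel strands, which are then braided by
`h` and all receive the label `h`. -/
def expand [hn : n.AtLeastTwo] (i : ℕ) (g : LabelledBraid n m H) :
    LabelledBraid n (m + n - 1) H where
  braid := cable n m i g.braid * insertBraid n m i (g.label i)
  label := splitLabel n g.label i
  label_eq_one := by
    have := hn.prop
    intro j hj
    unfold splitLabel
    split_ifs <;> exact g.label_eq_one _ (by omega)

theorem splitLabel_block {K : Type} (l : ℕ → K) {i t : ℕ} (h1 : i ≤ t) (h2 : t < i + n) :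
    splitLabel n l i t = l i := by
  unfold splitLabel
  rw [if_neg (by omega), if_pos h2]

theorem shift_outside {n i j : ℕ} (h : j ≠ i) : shift n i j < i ∨ i + n ≤ shift n i j := by
  unfold shift
  split_ifs <;> omega

variable [hn : n.AtLeastTwo]

theorem splitLabel_shift {K : Type} (l : ℕ → K) {i j : ℕ} (h : j ≠ i) :
    splitLabel n l i (shift n i j) = l j := by
  have := hn.prop
  unfold splitLabel shift
  split_ifs <;> first | rfl | omega | (congr 1; omega)

theorem shift_or_block (n i t : ℕ) [hn : n.AtLeastTwo] :
    (∃ j, j ≠ i ∧ t = shift n i j ∧ (t < i ∨ i + n ≤ t)) ∨ (i ≤ t ∧ t < i + n) := by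
  have := hn.prop
  unfold shift
  rcases (by omega : t < i ∨ (i ≤ t ∧ t < i + n) ∨ i + n ≤ t) with h | h | h
  · exact Or.inl ⟨t, by omega, by rw [if_pos h], Or.inl h⟩
  · exact Or.inr h
  · exact Or.inl ⟨t + 1 - n, by omega, by rw [if_neg (by omega)]; omega, Or.inr h⟩

theorem expand_perm_shift {i : ℕ} (hi : i < m) (g : LabelledBraid n m H) {j : ℕ} (h : j ≠ i) :
    strandPerm _ (expand i g).braid (shift n i j) =
      shift n (strandPerm m g.braid i) (strandPerm m g.braid j) := by
  simp only [expand, map_mul, Equiv.Perm.mul_apply]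
  rw [(strandPerm_insertBraid hi _ _).1 (shift_outside h), (strandPerm_cable _ i).2 j h]

theorem expand_perm_block {i : ℕ} (hi : i < m) (g : LabelledBraid n m H) {t : ℕ} (h1 : i ≤ t)
    (h2 : t < i + n) :
    strandPerm m g.braid i ≤ strandPerm _ (expand i g).braid t ∧
      strandPerm _ (expand i g).braid t < strandPerm m g.braid i + n := by
  simp only [expand, map_mul, Equiv.Perm.mul_apply]
  have h := (strandPerm_insertBraid hi (g.label i : BraidGroup n) t).2 ⟨h1, h2⟩
  generalize strandPerm _ (insertBraid n m i (g.label i : BraidGroup n)) t = u at h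
  obtain ⟨s, rfl⟩ := Nat.exists_eq_add_of_le h.1
  rw [(strandPerm_cable _ i).1 s (by omega)]
  omega

theorem expand_mul {i : ℕ} (hi : i < m) (g g' : LabelledBraid n m H) :
    expand i (g * g') = expand (strandPerm m g'.braid i) g * expand i g' := by
  refine ext_of ?_ (fun t => ?_)
  · simp only [expand, mul_braid, mul_label, cable_mul, Subgroup.coe_mul, map_mul]
    simp only [mul_assoc]
    congr 1
    rw [← mul_assoc, ← mul_assoc, insertBraid_cable _ _ _ hi]
  · rw [mul_label]
    rcases shift_or_block n i t with ⟨j, hj, rfl, _⟩ | ⟨h1, h2⟩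
    · rw [expand_perm_shift hi g' hj]
      simp only [expand]
      rw [splitLabel_shift _ hj, splitLabel_shift _ hj, splitLabel_shift _ (by simpa using hj)]
      rfl
    · have := expand_perm_block hi g' h1 h2
      revert this
      generalize strandPerm _ (expand i g').braid t = u
      intro this
      simp only [expand]
      rw [splitLabel_block _ h1 h2, splitLabel_block _ h1 h2, splitLabel_block _ this.1 this.2]
      rfl

theorem expand_one (i : ℕ) : expand i (1 : LabelledBraid n m H) = 1 := by
  refine ext_of ?_ (fun t => ?_)
  · simp [expand, cable_one]
  · simp only [expand, splitLabel]
    split_ifs <;> rfl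

theorem expand_inv {i : ℕ} (hi : i < m) (g : LabelledBraid n m H) :
    expand (strandPerm m g.braid i) g⁻¹ = (expand i g)⁻¹ := by
  rw [eq_inv_iff_mul_eq_one, ← expand_mul hi, inv_mul_cancel, expand_one]

theorem splitLabel_comm {K : Type} (l : ℕ → K) {i j : ℕ} (h : i < j) (t : ℕ) :
    splitLabel n (splitLabel n l j) i t = splitLabel n (splitLabel n l i) (j + n - 1) t := by
  have := hn.prop
  unfold splitLabel
  rcases (by omega : t < i ∨ (i ≤ t ∧ t < i + n) ∨ (i + n ≤ t ∧ t < j + n - 1) ∨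
    (j + n - 1 ≤ t ∧ t < j + n - 1 + n) ∨ j + n - 1 + n ≤ t) with h1 | h1 | h1 | h1 | h1
  · rw [if_pos h1, if_pos (by omega), if_pos (by omega), if_pos h1]
  · rw [if_neg (by omega), if_pos h1.2, if_pos h, if_pos (by omega), if_neg (by omega),
      if_pos h1.2]
  · rw [if_neg (by omega), if_neg (by omega), if_pos (by omega), if_pos (by omega),
      if_neg (by omega), if_neg (by omega)]
  · rw [if_neg (by omega), if_neg (by omega), if_neg (by omega), if_pos (by omega),
      if_neg (by omega), if_pos (by omega), if_neg (by omega), if_neg (by omega)]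
    congr 1
    omega
  · rw [if_neg (by omega), if_neg (by omega), if_neg (by omega), if_neg (by omega),
      if_neg (by omega), if_neg (by omega), if_neg (by omega), if_neg (by omega)]

theorem expand_expand {i j : ℕ} (hi : i < m) (hj : j < m) (h : i ≠ j) (g : LabelledBraid n m H) :
    expand (shift n j i) (expand j g) = expand (shift n i j) (expand i g) := by
  have := hn.prop
  refine ext_of ?_ (fun t => ?_)
  · simp only [expand]
    rw [cable_mul, cable_mul, (strandPerm_insertBraid hi _ _).1 (shift_outside h.symm),
      (strandPerm_insertBraid hj _ _).1 (shift_outside h), cable_insertBraid hi h,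
      cable_insertBraid hj h.symm, cable_cable _ _ _ h, splitLabel_shift _ h,
      splitLabel_shift _ h.symm, mul_assoc, mul_assoc]
    congr 1
    rcases Nat.lt_or_gt_of_ne h with h | h
    · symm
      apply insertBraid_comm <;> (unfold shift; split_ifs <;> omega)
    · apply insertBraid_comm <;> (unfold shift; split_ifs <;> omega)
  · simp only [expand, shift]
    rcases Nat.lt_or_gt_of_ne h with h | h
    · rw [if_pos h, if_neg (by omega), splitLabel_comm _ h]
    · rw [if_neg (by omega), if_pos h, splitLabel_comm _ h]

end LabelledBraid

/-! ## Forests -/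

/-- Vertices of the forest of `r` infinite `n`-ary trees: the index of a tree and a finite word on
the alphabet `{0, …, n - 1}`. Equivalently, the cones (basic intervals) of `r` disjoint copies of
the `n`-adic Cantor set. -/
abbrev Vertex (n r : ℕ) : Type := Fin r × List (Fin n)

/-- The `n` children of a vertex, from left to right. -/
def children {n r : ℕ} (v : Vertex n r) : List (Vertex n r) :=
  (List.finRange n).map fun a => (v.1, v.2 ++ [a])

/-- Append a caret to the `i`-th leaf (counted from `0`) of a list of leaves. -/
def appendCaret {n r : ℕ} : List (Vertex n r) → ℕ → List (Vertex n r)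
  | [], _ => []
  | v :: L, 0 => children v ++ L
  | v :: L, i + 1 => v :: appendCaret L i

/-- The roots of the `r` trees. -/
def roots (n r : ℕ) : List (Vertex n r) := (List.finRange r).map fun a => (a, [])

/-- `IsForest L` says that `L` is the list of leaves, from left to right, of a forest of `r` finite
full `n`-ary trees, that is, `L` arises from the `r` roots by appending carets. -/
inductive IsForest {n r : ℕ} : List (Vertex n r) → Prop
  | roots : IsForest (roots n r)
  | caret {L : List (Vertex n r)} {i : ℕ} : IsForest L → i < L.length → IsForest (appendCaret L i)

section forest

variable {n r : ℕ}

theorem length_children (v : Vertex n r) : (children v).length = n := by simp [children]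

theorem length_appendCaret (L : List (Vertex n r)) {i : ℕ} (hi : i < L.length) :
    (appendCaret L i).length = L.length + n - 1 := by
  induction L generalizing i with
  | nil => simp at hi
  | cons v L ih =>
    cases i with
    | zero => simp [appendCaret, length_children]; omega
    | succ i =>
      simp only [List.length_cons] at hi
      rw [appendCaret, List.length_cons, ih (by omega), List.length_cons]; omega

theorem appendCaret_append (A L : List (Vertex n r)) (i : ℕ) :
    appendCaret (A ++ L) (A.length + i) = A ++ appendCaret L i := by
  induction A with
  | nil => simp
  | cons v A ih =>
    rw [List.length_cons, show A.length + 1 + i = (A.length + i) + 1 by omega, List.cons_append,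
      appendCaret, ih, List.cons_append]

theorem appendCaret_comm_lt (L : List (Vertex n r)) {i j : ℕ} (h : i < j) :
    appendCaret (appendCaret L i) (j + n - 1) = appendCaret (appendCaret L j) i := by
  induction L generalizing i j with
  | nil => simp [appendCaret]
  | cons v L ih =>
    obtain ⟨j, rfl⟩ : ∃ k, j = k + 1 := ⟨j - 1, by omega⟩
    cases i with
    | zero =>
      simp only [appendCaret]
      rw [show j + 1 + n - 1 = (children v).length + j by rw [length_children]; omega,
        appendCaret_append]
    | succ i =>
      simp only [appendCaret]
      rw [← ih (by omega), show j + 1 + n - 1 = (j + n - 1) + 1 by omega, appendCaret]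

theorem appendCaret_comm (L : List (Vertex n r)) {i j : ℕ} (h : i ≠ j) :
    appendCaret (appendCaret L j) (shift n j i) = appendCaret (appendCaret L i) (shift n i j) := by
  unfold shift
  rcases Nat.lt_or_gt_of_ne h with h | h
  · rw [if_pos h, if_neg (by omega), appendCaret_comm_lt L h]
  · rw [if_neg (by omega), if_pos h, appendCaret_comm_lt L h]

theorem appendCaret_eq (L : List (Vertex n r)) {i : ℕ} (hi : i < L.length) :
    ∃ A B, L = A ++ L[i] :: B ∧ A.length = i ∧ appendCaret L i = A ++ children L[i] ++ B := by
  induction L generalizing i with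
  | nil => simp at hi
  | cons v L ih =>
    cases i with
    | zero => exact ⟨[], L, by simp, rfl, by simp [appendCaret]⟩
    | succ i =>
      obtain ⟨A, B, h1, h2, h3⟩ := ih (i := i) (by simpa using hi)
      refine ⟨v :: A, B, ?_, by simp [h2], ?_⟩
      · simpa using h1
      · simpa [appendCaret] using h3

/-- `u` is an ancestor of `v`, or equal to it. -/
def Above (u v : Vertex n r) : Prop := u.1 = v.1 ∧ u.2 <+: v.2

theorem mem_children {u v : Vertex n r} : u ∈ children v ↔ ∃ a, u = (v.1, v.2 ++ [a]) := by
  simp [children, eq_comm]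

theorem above_of_child {u v w : Vertex n r} (h : u ∈ children v) (hw : Above u w) : Above v w := by
  obtain ⟨a, rfl⟩ := mem_children.1 h
  exact ⟨hw.1, (List.prefix_append _ _).trans hw.2⟩

theorem above_child {u v w : Vertex n r} (h : u ∈ children v) (hw : Above w u) :
    Above w v ∨ w = u := by
  obtain ⟨a, rfl⟩ := mem_children.1 h
  rcases List.prefix_concat_iff.1 hw.2 with h2 | h2
  · exact Or.inr (Prod.ext hw.1 h2)
  · exact Or.inl ⟨hw.1, h2⟩

theorem not_above_of_child {u v : Vertex n r} (h : u ∈ children v) : ¬ Above u v := by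
  obtain ⟨a, rfl⟩ := mem_children.1 h
  intro h
  have := h.2.length_le
  simp at this

/-- Distinct leaves of a forest are not comparable. -/
theorem IsForest.pairwise {L : List (Vertex n r)} (h : IsForest L) :
    L.Pairwise fun u v => ¬ Above u v ∧ ¬ Above v u := by
  induction h with
  | roots =>
    rw [BraidedThompson.roots, List.pairwise_map]
    refine (List.nodup_finRange r).imp ?_
    intro a b hab
    exact ⟨fun h => hab h.1, fun h => hab h.1.symm⟩
  | @caret L i hL hi ih =>
    obtain ⟨A, B, h1, h2, h3⟩ := appendCaret_eq L hi
    rw [h3]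
    generalize L[i] = v at h1 h3
    rw [h1] at ih
    rw [List.pairwise_append, List.pairwise_cons] at ih
    obtain ⟨hA, ⟨hv, hB⟩, hAB⟩ := ih
    rw [List.append_assoc, List.pairwise_append, List.pairwise_append]
    refine ⟨hA, ⟨?_, hB, ?_⟩, ?_⟩
    · rw [children, List.pairwise_map]
      refine (List.nodup_finRange n).imp ?_
      intro a b hab
      constructor
      · intro h
        exact hab (by simpa using h.2.eq_of_length (by simp))
      · intro h
        exact hab (by simpa using (h.2.eq_of_length (by simp)).symm)
    · intro u hu w hw
      refine ⟨fun h => (hv w hw).1 (above_of_child hu h), fun h => ?_⟩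
      rcases above_child hu h with h | rfl
      · exact (hv w hw).2 h
      · exact (hv w hw).1 (above_of_child hu ⟨rfl, List.prefix_refl _⟩)
    · intro w hw u hu
      rcases List.mem_append.1 hu with hu | hu
      · have hwv := hAB w hw v (by simp)
        refine ⟨fun h => ?_, fun h => hwv.2 (above_of_child hu h)⟩
        rcases above_child hu h with h | rfl
        · exact hwv.1 h
        · exact hwv.2 (above_of_child hu ⟨rfl, List.prefix_refl _⟩)
      · exact hAB w hw u (by simp [hu])

theorem IsForest.not_above {L : List (Vertex n r)} (h : IsForest L) {i : ℕ} (hi : i < L.length) :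
    ∀ u ∈ appendCaret L i, ¬ Above u L[i] := by
  intro u hu
  have hp := h.pairwise
  obtain ⟨A, B, h1, h2, h3⟩ := appendCaret_eq L hi
  rw [h3] at hu
  generalize L[i] = v at h1 h3 hu
  rw [h1, List.pairwise_append, List.pairwise_cons] at hp
  obtain ⟨hA, ⟨hv, hB⟩, hAB⟩ := hp
  rcases List.mem_append.1 hu with hu | hu
  · rcases List.mem_append.1 hu with hu | hu
    · exact (hAB u hu v (by simp)).1
    · exact not_above_of_child hu
  · exact (hv u hu).2

theorem not_above_appendCaret {L : List (Vertex n r)} {v : Vertex n r}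
    (h : ∀ u ∈ L, ¬ Above u v) {j : ℕ} (hj : j < L.length) :
    ∀ u ∈ appendCaret L j, ¬ Above u v := by
  intro u hu
  obtain ⟨A, B, h1, h2, h3⟩ := appendCaret_eq L hj
  rw [h3] at hu
  rcases List.mem_append.1 hu with hu | hu
  · rcases List.mem_append.1 hu with hu | hu
    · exact h u (by rw [h1]; simp [hu])
    · exact fun h' => h _ (List.getElem_mem hj) (above_of_child hu h')
  · exact h u (by rw [h1]; simp [hu])

theorem getElem_appendCaret {L : List (Vertex n r)} {i j : ℕ} (hi : i < L.length)
    (h : i ≠ j) (hs : shift n j i < (appendCaret L j).length) :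
    (appendCaret L j)[shift n j i] = L[i] := by
  induction L generalizing i j with
  | nil => simp at hi
  | cons v L ih =>
    cases j with
    | zero =>
      obtain ⟨i, rfl⟩ : ∃ k, i = k + 1 := ⟨i - 1, by omega⟩
      simp only [appendCaret, shift]
      have : i + 1 + n - 1 = (children v).length + i := by rw [length_children]; omega
      simp [this]
    | succ j =>
      cases i with
      | zero => simp [appendCaret, shift]
      | succ i =>
        have e : shift n (j + 1) (i + 1) = shift n j i + 1 := by
          unfold shift
          split_ifs <;> omega
        simp only [appendCaret, e, List.length_cons] at hs ⊢
        simp only [List.getElem_cons_succ]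
        exact ih _ (by omega) (by omega)

/-- `L'` arises from `L` by appending one caret. -/
def CaretStep (L L' : List (Vertex n r)) : Prop := ∃ i < L.length, L' = appendCaret L i

theorem steps_from_roots {L : List (Vertex n r)} (h : IsForest L) :
    Relation.ReflTransGen CaretStep (roots n r) L := by
  induction h with
  | roots => exact .refl
  | caret _ hi ih => exact ih.tail ⟨_, hi, rfl⟩

end forest

/-! ## The groups `BV_{n,r}(H)` -/

/-- A braided forest pair `(T, β, λ, T')`: two forests of `r` finite full `n`-ary trees with the same
number `m` of leaves and a braid `β` on `m` strands from the leaves of `T` (top) to the leaves of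
`T'` (bottom), with a label in `H` on each strand. -/
structure ForestPair (n r : ℕ) (H : Subgroup (BraidGroup n)) where
  m : ℕ
  dom : List (Vertex n r)
  ran : List (Vertex n r)
  dom_forest : IsForest dom
  ran_forest : IsForest ran
  dom_length : dom.length = m
  ran_length : ran.length = m
  braid : LabelledBraid n m H

namespace ForestPair

variable {n r : ℕ} {H : Subgroup (BraidGroup n)}

theorem mk_congr {m : ℕ} {T T' S S' : List (Vertex n r)} {g g' : LabelledBraid n m H}
    {h1 h2 h3 h4 h1' h2' h3' h4'} (hT : T = T') (hS : S = S') (hg : g = g') :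
    (⟨m, T, S, h1, h2, h3, h4, g⟩ : ForestPair n r H) = ⟨m, T', S', h1', h2', h3', h4', g'⟩ := by
  subst hT hS hg
  rfl

/-- The top position of the strand ending at the `i`-th leaf of the range forest. -/
def perm (D : ForestPair n r H) : Equiv.Perm ℕ := strandPerm D.m D.braid.braid

theorem perm_lt (D : ForestPair n r H) {i : ℕ} (hi : i < D.m) : D.perm i < D.m :=
  (strandPerm_lt _ _).2 hi

/-- The inverse `(T', β⁻¹, λ', T)` of `(T, β, λ, T')`. -/
def symm (D : ForestPair n r H) : ForestPair n r H where
  m := D.m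
  dom := D.ran
  ran := D.dom
  dom_forest := D.ran_forest
  ran_forest := D.dom_forest
  dom_length := D.ran_length
  ran_length := D.dom_length
  braid := D.braid⁻¹

theorem symm_symm (D : ForestPair n r H) : D.symm.symm = D :=
  mk_congr rfl rfl (inv_inv _)

/-- `Comp D D' P`: the range forest of `D` is the domain forest of `D'`, and
`P = (T, ββ', λλ', T'')` is the composition of `D = (T, β, λ, T')` and `D' = (T', β', λ', T'')`. -/
inductive Comp : ForestPair n r H → ForestPair n r H → ForestPair n r H → Prop
  | mk (m : ℕ) (T S U : List (Vertex n r)) (hT : IsForest T) (hS : IsForest S) (hU : IsForest U)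
      (lT : T.length = m) (lS : S.length = m) (lU : U.length = m) (g g' : LabelledBraid n m H) :
      Comp ⟨m, T, S, hT, hS, lT, lS, g⟩ ⟨m, S, U, hS, hU, lS, lU, g'⟩
        ⟨m, T, U, hT, hU, lT, lU, g * g'⟩

theorem Comp.exists {D D' : ForestPair n r H} (h : D.ran = D'.dom) : ∃ P, Comp D D' P := by
  obtain ⟨m, T, S, hT, hS, lT, lS, g⟩ := D
  obtain ⟨m', S', U, hS', hU, lS', lU, g'⟩ := D'
  obtain rfl : S = S' := h
  obtain rfl : m = m' := lS.symm.trans lS'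
  exact ⟨_, .mk m T S U hT hS hU lT lS lU g g'⟩

theorem Comp.ran_eq {D D' P : ForestPair n r H} (h : Comp D D' P) : D.ran = D'.dom := by
  cases h; rfl

theorem Comp.unique {D D' P Q : ForestPair n r H} (h : Comp D D' P) (h' : Comp D D' Q) :
    P = Q := by
  cases h; cases h'; rfl

variable [hn : n.AtLeastTwo]

/-- The expansion of a braided forest pair at the `i`-th leaf of the range forest: carets are
appended to this leaf and to the leaf of the domain forest that is joined to it, and the labelled
braid is expanded at the strand joining them. -/
def expand (D : ForestPair n r H) (i : ℕ) (hi : i < D.m) : ForestPair n r H where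
  m := D.m + n - 1
  dom := appendCaret D.dom (strandPerm D.m D.braid.braid i)
  ran := appendCaret D.ran i
  dom_forest := D.dom_forest.caret (by rw [D.dom_length]; exact D.perm_lt hi)
  ran_forest := D.ran_forest.caret (by rw [D.ran_length]; exact hi)
  dom_length := by
    rw [length_appendCaret _ (by rw [D.dom_length]; exact D.perm_lt hi), D.dom_length]
  ran_length := by rw [length_appendCaret _ (by rw [D.ran_length]; exact hi), D.ran_length]
  braid := D.braid.expand i

/-- `D'` is an expansion of `D` by one caret on either side. -/
def Step (D D' : ForestPair n r H) : Prop := ∃ i, ∃ hi : i < D.m, D' = D.expand i hi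

theorem shift_lt {m i j : ℕ} (hi : i < m) : shift n j i < m + n - 1 := by
  have := hn.prop
  unfold shift
  split_ifs <;> omega

theorem expand_expand (D : ForestPair n r H) {i j : ℕ} (hi : i < D.m) (hj : j < D.m) (h : i ≠ j) :
    (D.expand j hj).expand (shift n j i) (shift_lt hi) =
      (D.expand i hi).expand (shift n i j) (shift_lt hj) := by
  refine mk_congr ?_ (appendCaret_comm _ h) (LabelledBraid.expand_expand hi hj h _)
  change appendCaret (appendCaret D.dom _)
      (strandPerm (D.m + n - 1) (LabelledBraid.expand j D.braid).braid (shift n j i)) =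
    appendCaret (appendCaret D.dom _)
      (strandPerm (D.m + n - 1) (LabelledBraid.expand i D.braid).braid (shift n i j))
  rw [LabelledBraid.expand_perm_shift hj _ h, LabelledBraid.expand_perm_shift hi _ h.symm]
  exact appendCaret_comm _ (by simpa using h)

theorem diamond (D D1 D2 : ForestPair n r H) (h1 : Step D D1) (h2 : Step D D2) :
    ∃ E, Relation.ReflGen Step D1 E ∧ Relation.ReflTransGen Step D2 E := by
  obtain ⟨i, hi, rfl⟩ := h1
  obtain ⟨j, hj, rfl⟩ := h2
  by_cases h : i = j
  · subst h; exact ⟨_, .refl, .refl⟩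
  · exact ⟨_, .single ⟨_, shift_lt hj, rfl⟩, .single ⟨_, shift_lt hi, (expand_expand D hi hj h).symm⟩⟩

/-- Expansion up to several carets. -/
abbrev Steps : ForestPair n r H → ForestPair n r H → Prop := Relation.ReflTransGen Step

theorem join_of_eq {D D' : ForestPair n r H} (h : Quot.mk Step D = Quot.mk Step D') :
    ∃ E, Steps D E ∧ Steps D' E := by
  replace h := Quot.eqvGen_exact h
  induction h with
  | rel a b h => exact ⟨b, .single h, .refl⟩
  | refl a => exact ⟨a, .refl, .refl⟩
  | symm a b _ ih => obtain ⟨E, h1, h2⟩ := ih; exact ⟨E, h2, h1⟩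
  | trans a b c _ _ ih1 ih2 =>
    obtain ⟨E, h1, h2⟩ := ih1
    obtain ⟨F, h3, h4⟩ := ih2
    obtain ⟨K, h5, h6⟩ := Relation.church_rosser diamond h2 h3
    exact ⟨K, h1.trans h5, h4.trans h6⟩

theorem eq_of_steps {D D' : ForestPair n r H} (h : Steps D D') :
    Quot.mk Step D = Quot.mk Step D' := by
  induction h with
  | refl => rfl
  | tail _ h ih => exact ih.trans (Quot.sound h)

/-! ### The expansion is determined by its range forest -/

theorem leaf_not_mem {D E : ForestPair n r H} {i : ℕ} (hi : i < D.m)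
    (h : Steps (D.expand i hi) E) :
    ∀ u ∈ E.ran, ¬ Above u (D.ran[i]'(by rw [D.ran_length]; exact hi)) := by
  induction h with
  | refl => exact D.ran_forest.not_above _
  | tail _ h ih =>
    obtain ⟨j, hj, rfl⟩ := h
    exact not_above_appendCaret ih (by rw [ran_length]; exact hj)

theorem expand_steps {D E : ForestPair n r H} (h : Steps D E) : ∀ {i : ℕ} (hi : i < D.m),
    (D.ran[i]'(by rw [D.ran_length]; exact hi)) ∉ E.ran → Steps (D.expand i hi) E := by
  induction h using Relation.ReflTransGen.head_induction_on with
  | refl => intro i hi h; exact absurd (List.getElem_mem _) h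
  | @head D D' h h' ih =>
    intro i hi hmem
    obtain ⟨j, hj, rfl⟩ := h
    by_cases hij : i = j
    · subst hij; exact h'
    · have e := getElem_appendCaret (L := D.ran) (by rw [D.ran_length]; exact hi) hij
        (by rw [length_appendCaret _ (by rw [D.ran_length]; exact hj), D.ran_length]
            exact shift_lt hi)
      have h2 := ih (i := shift n j i) (shift_lt hi) (fun hm => hmem (e ▸ hm))
      rw [expand_expand D hi hj hij] at h2
      exact .head ⟨_, shift_lt hj, rfl⟩ h2

theorem steps_unique {D E E' : ForestPair n r H} (h : Steps D E) (h' : Steps D E')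
    (hr : E.ran = E'.ran) : E = E' := by
  induction h using Relation.ReflTransGen.head_induction_on with
  | refl =>
    rcases Relation.ReflTransGen.cases_head h' with rfl | ⟨F, ⟨i, hi, rfl⟩, h2⟩
    · rfl
    · exfalso
      refine leaf_not_mem hi h2 (E.ran[i]'(by rw [E.ran_length]; exact hi)) ?_
        ⟨rfl, List.prefix_refl _⟩
      rw [← hr]
      exact List.getElem_mem _
  | @head D D' h h2 ih =>
    obtain ⟨i, hi, rfl⟩ := h
    refine ih (expand_steps h' hi ?_)
    intro hm
    rw [← hr] at hm
    exact leaf_not_mem hi h2 _ hm ⟨rfl, List.prefix_refl _⟩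

/-! ### Expansions of inverses -/

theorem symm_expand (D : ForestPair n r H) {i : ℕ} (hi : i < D.m) :
    (D.expand i hi).symm = D.symm.expand (D.perm i) (D.perm_lt hi) := by
  refine mk_congr ?_ rfl (LabelledBraid.expand_inv hi _).symm
  change appendCaret D.ran i =
    appendCaret D.ran (strandPerm D.m D.braid.braid⁻¹ (strandPerm D.m D.braid.braid i))
  rw [map_inv, perm_inv_apply]

theorem symm_step {D E : ForestPair n r H} (h : Step D E) : Step D.symm E.symm := by
  obtain ⟨i, hi, rfl⟩ := h
  exact ⟨_, D.perm_lt hi, D.symm_expand hi⟩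

theorem symm_steps {D E : ForestPair n r H} (h : Steps D E) : Steps D.symm E.symm :=
  h.lift symm fun _ _ => symm_step

theorem steps_unique_dom {D E E' : ForestPair n r H} (h : Steps D E) (h' : Steps D E')
    (hr : E.dom = E'.dom) : E = E' := by
  have := steps_unique (symm_steps h) (symm_steps h') hr
  rw [← symm_symm E, this, symm_symm]

/-! ### Expansions of composites -/

theorem Comp.step {D D' P E : ForestPair n r H} (h : Comp D D' P) (hs : Step D E) :
    ∃ E' Q, Step D' E' ∧ Step P Q ∧ Comp E E' Q := by
  obtain ⟨i, hi, rfl⟩ := hs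
  cases h with
  | mk m T S U hT hS hU lT lS lU g g' =>
    simp only at hi
    obtain ⟨j, rfl⟩ : ∃ j, i = strandPerm m g'.braid j :=
      ⟨(strandPerm m g'.braid)⁻¹ i, by simp⟩
    have hj : j < m := (strandPerm_lt _ _).1 hi
    obtain ⟨Q, hQ⟩ := Comp.exists
      (D := expand ⟨m, T, S, hT, hS, lT, lS, g⟩ (strandPerm m g'.braid j) hi)
      (D' := expand ⟨m, S, U, hS, hU, lS, lU, g'⟩ j hj) rfl
    refine ⟨_, Q, ⟨j, hj, rfl⟩, ⟨j, hj, ?_⟩, hQ⟩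
    refine hQ.unique ?_
    have e : expand ⟨m, T, U, hT, hU, lT, lU, g * g'⟩ j hj =
        ⟨m + n - 1, appendCaret T (strandPerm m g.braid (strandPerm m g'.braid j)),
          appendCaret U j, hT.caret (by rw [lT, strandPerm_lt]; exact hi),
          hU.caret (by rw [lU]; exact hj),
          by rw [length_appendCaret _ (by rw [lT, strandPerm_lt]; exact hi), lT],
          by rw [length_appendCaret _ (by rw [lU]; exact hj), lU],
          LabelledBraid.expand (strandPerm m g'.braid j) g * LabelledBraid.expand j g'⟩ :=
      mk_congr (by simp) rfl (LabelledBraid.expand_mul hj g g')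
    rw [e]
    exact .mk _ _ _ _ _ _ _ _ _ _ _ _

theorem Comp.steps {D D' P E : ForestPair n r H} (h : Comp D D' P) (hs : Steps D E) :
    ∃ E' Q, Steps D' E' ∧ Steps P Q ∧ Comp E E' Q := by
  induction hs with
  | refl => exact ⟨D', P, .refl, .refl, h⟩
  | tail _ hs ih =>
    obtain ⟨E', Q, h1, h2, h3⟩ := ih
    obtain ⟨E'', Q', h4, h5, h6⟩ := h3.step hs
    exact ⟨E'', Q', h1.tail h4, h2.tail h5, h6⟩

theorem Comp.steps_of_eq {D D' P E E' : ForestPair n r H} (h : Comp D D' P) (hs : Steps D E)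
    (hs' : Steps D' E') (he : E.ran = E'.dom) : ∃ Q, Steps P Q ∧ Comp E E' Q := by
  obtain ⟨F, Q, h1, h2, h3⟩ := h.steps hs
  obtain rfl : F = E' := steps_unique_dom h1 hs' (by rw [← h3.ran_eq, he])
  exact ⟨Q, h2, h3⟩

/-! ### Common expansions -/

theorem exists_step_of_ran (D : ForestPair n r H) {L : List (Vertex n r)} (h : CaretStep D.ran L) :
    ∃ E, Step D E ∧ E.ran = L := by
  obtain ⟨i, hi, rfl⟩ := h
  rw [D.ran_length] at hi
  exact ⟨D.expand i hi, ⟨i, hi, rfl⟩, rfl⟩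

theorem exists_steps_of_ran (D : ForestPair n r H) {L : List (Vertex n r)}
    (h : Relation.ReflTransGen CaretStep D.ran L) : ∃ E, Steps D E ∧ E.ran = L := by
  induction h with
  | refl => exact ⟨D, .refl, rfl⟩
  | tail _ h ih =>
    obtain ⟨E, h1, rfl⟩ := ih
    obtain ⟨F, h2, rfl⟩ := E.exists_step_of_ran h
    exact ⟨F, h1.tail h2, rfl⟩

theorem exists_steps_of_dom (D : ForestPair n r H) {L : List (Vertex n r)}
    (h : Relation.ReflTransGen CaretStep D.dom L) : ∃ E, Steps D E ∧ E.dom = L := by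
  obtain ⟨E, h1, h2⟩ := D.symm.exists_steps_of_ran h
  refine ⟨E.symm, ?_, h2⟩
  have := symm_steps h1
  rwa [symm_symm] at this

theorem caret_diamond (L L1 L2 : List (Vertex n r)) (h1 : CaretStep L L1) (h2 : CaretStep L L2) :
    ∃ K, Relation.ReflGen CaretStep L1 K ∧ Relation.ReflTransGen CaretStep L2 K := by
  obtain ⟨i, hi, rfl⟩ := h1
  obtain ⟨j, hj, rfl⟩ := h2
  by_cases h : i = j
  · subst h; exact ⟨_, .refl, .refl⟩
  · refine ⟨_, .single ⟨shift n i j, ?_, rfl⟩,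
      .single ⟨shift n j i, ?_, (appendCaret_comm _ h).symm⟩⟩
    · rw [length_appendCaret _ hi]; exact shift_lt hj
    · rw [length_appendCaret _ hj]; exact shift_lt hi

theorem common_expansion {L L' : List (Vertex n r)} (h : IsForest L) (h' : IsForest L') :
    ∃ K, Relation.ReflTransGen CaretStep L K ∧ Relation.ReflTransGen CaretStep L' K :=
  Relation.church_rosser caret_diamond (steps_from_roots h) (steps_from_roots h')

theorem exists_composable (D D' : ForestPair n r H) :
    ∃ E E', Steps D E ∧ Steps D' E' ∧ E.ran = E'.dom := by
  obtain ⟨K, h1, h2⟩ := common_expansion D.ran_forest D'.dom_forest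
  obtain ⟨E, h3, h4⟩ := D.exists_steps_of_ran h1
  obtain ⟨E', h5, h6⟩ := D'.exists_steps_of_dom h2
  exact ⟨E, E', h3, h5, h4.trans h6.symm⟩

theorem Comp.well_defined {D D' P E E' Q : ForestPair n r H} (h : Comp D D' P) (h' : Comp E E' Q)
    (h1 : Quot.mk Step D = Quot.mk Step E) (h2 : Quot.mk Step D' = Quot.mk Step E') :
    Quot.mk Step P = Quot.mk Step Q := by
  obtain ⟨A, hA1, hA2⟩ := join_of_eq h1
  obtain ⟨B, hB1, hB2⟩ := join_of_eq h2
  obtain ⟨A', B', hA, hB, he⟩ := exists_composable A B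
  obtain ⟨R, hR1, hR2⟩ := h.steps_of_eq (hA1.trans hA) (hB1.trans hB) he
  obtain ⟨R', hR1', hR2'⟩ := h'.steps_of_eq (hA2.trans hA) (hB2.trans hB) he
  obtain rfl := hR2.unique hR2'
  exact (eq_of_steps hR1).trans (eq_of_steps hR1').symm

end ForestPair

/-- The braided Higman–Thompson group `BV_{n,r}(H)` on `r` copies of the `n`-adic Cantor set with
recursive braids of type `H`: its elements are the classes of braided forest pairs
`(T, β, λ, T')` under the equivalence relation generated by expansions. -/
def BV (n r : ℕ) [n.AtLeastTwo] (H : Subgroup (BraidGroup n)) : Type :=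
  Quot (ForestPair.Step (n := n) (r := r) (H := H))

namespace BV

open ForestPair

variable {n r : ℕ} [n.AtLeastTwo] {H : Subgroup (BraidGroup n)}

/-- The element of `BV n r H` represented by a braided forest pair. -/
def mk (D : ForestPair n r H) : BV n r H := Quot.mk _ D

theorem exists_rep (a b : BV n r H) : ∃ D D' P, mk D = a ∧ mk D' = b ∧ Comp D D' P := by
  induction a using Quot.ind with
  | mk D =>
  induction b using Quot.ind with
  | mk D' =>
  obtain ⟨E, E', h1, h2, h3⟩ := exists_composable D D'
  obtain ⟨P, hP⟩ := Comp.exists h3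
  exact ⟨E, E', P, (eq_of_steps h1).symm, (eq_of_steps h2).symm, hP⟩

/-- To multiply two elements, choose representatives `(T, β, λ, T')` and `(T', β', λ', T'')` and
compose them; the result does not depend on the choice, see `mk_mul_mk`. -/
noncomputable instance : Mul (BV n r H) :=
  ⟨fun a b => mk (exists_rep a b).choose_spec.choose_spec.choose⟩

theorem mk_mul_mk {D D' P : ForestPair n r H} (h : Comp D D' P) : mk D * mk D' = mk P := by
  have h' := (exists_rep (mk D) (mk D')).choose_spec.choose_spec.choose_spec
  exact Comp.well_defined h'.2.2 h h'.1 h'.2.1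

instance : One (BV n r H) :=
  ⟨mk ⟨(roots n r).length, roots n r, roots n r, .roots, .roots, rfl, rfl, 1⟩⟩

theorem symm_congr {D E : ForestPair n r H} (h : Step D E) : mk D.symm = mk E.symm :=
  Quot.sound (symm_step h)

instance : Inv (BV n r H) := ⟨Quot.lift (fun D => mk D.symm) fun _ _ => symm_congr⟩

theorem mk_inv (D : ForestPair n r H) : (mk D)⁻¹ = mk D.symm := rfl

theorem mk_expand (D : ForestPair n r H) (i : ℕ) (hi : i < D.m) : mk (D.expand i hi) = mk D :=
  (Quot.sound ⟨i, hi, rfl⟩ : mk D = mk (D.expand i hi)).symm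

theorem mk_id {m : ℕ} {L : List (Vertex n r)} (h : IsForest L) (l : L.length = m) :
    mk (⟨m, L, L, h, h, l, l, 1⟩ : ForestPair n r H) = 1 := by
  subst l
  induction h with
  | roots => rfl
  | @caret L i hL hi ih =>
    rw [← ih, ← mk_expand ⟨_, L, L, hL, hL, rfl, rfl, 1⟩ i hi]
    have l := length_appendCaret L hi
    have key : ∀ (m : ℕ) (h : (appendCaret L i).length = m),
        mk (⟨(appendCaret L i).length, appendCaret L i, appendCaret L i, hL.caret hi, hL.caret hi,
          rfl, rfl, 1⟩ : ForestPair n r H) =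
        mk ⟨m, appendCaret L i, appendCaret L i, hL.caret hi, hL.caret hi, h, h, 1⟩ := by
      intro m h; subst h; rfl
    rw [key _ l]
    exact congrArg mk (mk_congr (by simp) rfl (LabelledBraid.expand_one i).symm)

noncomputable instance : Group (BV n r H) :=
  Group.ofLeftAxioms
    (by
      intro a b c
      obtain ⟨D, D', P, rfl, rfl, hP⟩ := exists_rep a b
      induction c using Quot.ind with
      | mk F =>
      obtain ⟨E', E, h1, h2, h3⟩ := exists_composable D' F
      have hD : Relation.ReflTransGen CaretStep D.ran E'.dom := by
        rw [hP.ran_eq]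
        clear hP h3
        induction h1 with
        | refl => exact .refl
        | tail _ h ih =>
          obtain ⟨i, hi, rfl⟩ := h
          exact ih.tail ⟨_, by rw [dom_length]; exact perm_lt _ hi, rfl⟩
      obtain ⟨G, h4, h5⟩ := D.exists_steps_of_ran hD
      change mk D * mk D' * mk F = mk D * (mk D' * mk F)
      rw [show mk D = mk G from eq_of_steps h4, show mk D' = mk E' from eq_of_steps h1,
        show mk F = mk E from eq_of_steps h2]
      clear * - h3 h5
      obtain ⟨m, S, U, hS, hU, lS, lU, g'⟩ := E'
      obtain ⟨m1, T, S1, hT, hS1, lT, lS1, g⟩ := G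
      obtain ⟨m2, U2, V, hU2, hV, lU2, lV, g''⟩ := E
      simp only at h3 h5
      subst h3 h5 lS1 lS
      obtain rfl : m2 = S1.length := lU2.symm.trans lU
      rw [mk_mul_mk (.mk _ _ _ _ hT hS hU lT _ lU g g'),
        mk_mul_mk (.mk _ _ _ _ hT hU hV lT _ lV (g * g') g''),
        mk_mul_mk (.mk _ _ _ _ hS hU hV _ _ lV g' g''),
        mk_mul_mk (.mk _ _ _ _ hT hS hV lT _ lV g (g' * g'')), mul_assoc])
    (by
      intro a
      induction a using Quot.ind with
      | mk D =>
      obtain ⟨m, T, S, hT, hS, lT, lS, g⟩ := D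
      change 1 * mk _ = mk _
      rw [← mk_id hT lT, mk_mul_mk (.mk _ _ _ _ _ _ _ _ _ _ 1 g), one_mul])
    (by
      intro a
      induction a using Quot.ind with
      | mk D =>
      obtain ⟨m, T, S, hT, hS, lT, lS, g⟩ := D
      refine (mk_mul_mk (.mk _ _ _ _ hS hT hS lS lT lS g⁻¹ g)).trans ?_
      rw [inv_mul_cancel, mk_id])

end BV

end BraidedThompson

/-!
For two forests `T`, `S` with `m` leaves and a labelled braid `g` on `m` strands write `[T, g, S]`
for the element of `BV n r H` that they represent. Let `C_c` be the comb with `c` carets, in which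
each new caret hangs from the last leaf. Since
`[T, g, S] = [T, 1, C_c] [C_c, g, C_c] [C_c, 1, S]`, two kinds of elements have to be obtained from
finitely many ones.

* The elements `[T, 1, S]`, which form a copy of the Higman–Thompson group `F`. Adding the carets of
  `T` one at a time, one sees that they are products of the elements `y_{c,i} = [C_c ∧ i, 1, C_{c+1}]`
  and their inverses, where `C_c ∧ i` is `C_c` with a caret at its `i`-th leaf. An expansion at
  the last leaf shows that `y_{c,i} = y_{c+1,i}` unless `i` is the last leaf, in which case
  `y_{c,i} = 1`; and adding carets at two leaves `i < j` in either order gives the relation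
  `y_{c,i} y_{c+1,j+n-1} = y_{c,j} y_{c+1,i}` (`combCaret_mul_combCaret`) of Thompson's group. With
  `i = 0` it reduces large indices to smaller ones (`combCaret_mem`).
* The elements `[C_c, g, C_c]`, where `g` is an Artin generator or a single label from a finite
  generating set of `H`. Such a `g` involves at most two neighbouring strands, so if there are many
  strands, then there are at least `n` strands to one side of these. Expanding a trivial strand with
  trivial label on that side does not change the nature of `g`. Hence `[C_c, g, C_c]` with `c` large
  is, up to conjugation by an element `[T, 1, S]`, of the form `[C_{c-1}, g', C_{c-1}]`
  (`sigma_mem`, `single_mem`).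

So the elements `y_{c,i}` and `[C_c, g, C_c]` with `c ≤ 2 n` suffice.
-/

namespace BraidedThompson

namespace LabelledBraid

variable {n m : ℕ} {H : Subgroup (BraidGroup n)}

/-! ### Generators of the groups of labelled braids -/

/-- A braid, all of whose strands have the trivial label. -/
def ofBraid : BraidGroup m →* LabelledBraid n m H where
  toFun b := ⟨b, fun _ => 1, fun _ _ => rfl⟩
  map_one' := rfl
  map_mul' a b := ext_of rfl fun j => by simp

/-- The trivial braid with label `h` on the strand in position `j` and trivial labels elsewhere. -/
def single (j : Fin m) : H →* LabelledBraid n m H where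
  toFun h := ⟨1, fun t => if t = j then h else 1, fun t ht => if_neg (by omega)⟩
  map_one' := ext_of rfl fun t => by simp
  map_mul' a b := ext_of (by simp) fun t => by
    simp only [mul_label, map_one, Equiv.Perm.one_apply]
    split_ifs <;> simp

/-- A subgroup that contains all Artin generators and all labels of single strands is everything. -/
theorem eq_top_of_generators (K : Subgroup (LabelledBraid n m H))
    (hσ : ∀ k, k + 1 < m → ofBraid (sigma m k) ∈ K) (hl : ∀ j h, single j h ∈ K) : K = ⊤ := by
  refine (Subgroup.eq_top_iff' K).2 fun g => ?_
  have hb : ∀ b : BraidGroup m, ofBraid b ∈ K := by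
    intro b
    induction b using braid_induction with
    | h1 => rw [map_one]; exact K.one_mem
    | hg k hk => exact hσ k hk
    | hm a b ha hb => rw [map_mul]; exact K.mul_mem ha hb
    | hi a ha => rw [map_inv]; exact K.inv_mem ha
  -- The labels of the first `s` strands are assembled one by one.
  have hs : ∀ s ≤ m, ∀ f : LabelledBraid n m H, f.braid = 1 → (∀ j, s ≤ j → f.label j = 1) →
      f ∈ K := by
    intro s
    induction s with
    | zero =>
      intro _ f h1 h2
      rw [show f = 1 from ext_of h1 fun j => h2 j (Nat.zero_le _)]
      exact K.one_mem
    | succ s ih =>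
      intro hsm f h1 h2
      have h3 := ih (by omega) (f * (single ⟨s, by omega⟩ (f.label s))⁻¹)
        (by simp [h1, single]) (by
          intro j hj
          rw [← map_inv]
          simp only [single, MonoidHom.coe_mk, OneHom.coe_mk, mul_label, map_one,
            Equiv.Perm.one_apply]
          rcases hj.eq_or_lt with rfl | hj
          · simp
          · rw [h2 j hj, if_neg (by omega), mul_one])
      exact (K.mul_mem_cancel_right (K.inv_mem (hl _ _))).1 h3
  have e : g = ofBraid g.braid * ⟨1, g.label, g.label_eq_one⟩ :=
    ext_of (by simp [ofBraid]) fun j => by simp [ofBraid]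
  rw [e]
  exact K.mul_mem (hb _) (hs m le_rfl _ rfl g.label_eq_one)

variable [hn : n.AtLeastTwo]

theorem expand_ofBraid (i : ℕ) (b : BraidGroup m) :
    expand i (ofBraid b : LabelledBraid n m H) = ofBraid (cable n m i b) := by
  refine ext_of (by simp [expand, ofBraid]) fun t => ?_
  simp [expand, ofBraid, splitLabel]

theorem expand_single {i : ℕ} (j : Fin m) (h : i ≠ j) (x : H) :
    expand i (single j x) =
      single (⟨shift n i j, ForestPair.shift_lt j.2⟩ : Fin (m + n - 1)) x := by
  refine ext_of (by simp [expand, single, cable_one, h]) fun t => ?_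
  rcases shift_or_block n i t with ⟨s, hs, rfl, _⟩ | ⟨h1, h2⟩
  · have := hn.prop
    have hst : shift n i s = shift n i j ↔ s = j := by
      unfold shift
      split_ifs <;> omega
    simp [expand, single, splitLabel_shift _ hs, hst]
  · have := shift_outside (n := n) h.symm
    simp only [expand, single, MonoidHom.coe_mk, OneHom.coe_mk, splitLabel_block _ h1 h2]
    rw [if_neg h, if_neg (by omega)]

end LabelledBraid

/-! ### Elements given by forests and a labelled braid -/

/-- Forests with `m` leaves, given by the list of their leaves. -/
abbrev Forest (n r m : ℕ) : Type := {L : List (Vertex n r) // IsForest L ∧ L.length = m}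

namespace Forest

variable {n r m : ℕ}

/-- Append a caret to the `i`-th leaf. -/
def caret (T : Forest n r m) (i : ℕ) (hi : i < m) : Forest n r (m + n - 1) :=
  ⟨appendCaret T.1 i, T.2.1.caret (by rw [T.2.2]; exact hi),
    by rw [length_appendCaret _ (by rw [T.2.2]; exact hi), T.2.2]⟩

variable (n r) in
/-- The number of leaves of a forest with `c` carets. -/
def leaves : ℕ → ℕ
  | 0 => r
  | c + 1 => leaves c + n - 1

variable [hn : n.AtLeastTwo] [hr : NeZero r]

variable (n r) in
theorem lt_leaves (c : ℕ) : c < leaves n r c := by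
  have := hn.prop
  induction c with
  | zero => exact Nat.pos_of_neZero r
  | succ c ih => rw [leaves]; omega

variable (n r) in
/-- The forest that arises from the `r` roots by appending `c` carets, always to the last leaf. -/
def comb : ∀ c, Forest n r (leaves n r c)
  | 0 => ⟨roots n r, .roots, by simp [roots, leaves]⟩
  | c + 1 => (comb c).caret (leaves n r c - 1) (by have := lt_leaves n r c; omega)

theorem appendCaret_comb_last (c : ℕ) {i : ℕ} (h : i + 1 < leaves n r c) :
    appendCaret (appendCaret (comb n r c).1 i) (leaves n r (c + 1) - 1) =
      appendCaret (comb n r (c + 1)).1 i := by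
  have e : leaves n r (c + 1) - 1 = leaves n r c - 1 + n - 1 := by
    have := hn.prop
    rw [leaves]
    omega
  rw [e, appendCaret_comm_lt _ (by omega)]
  rfl

end Forest

namespace BV

open Forest LabelledBraid

variable {n r : ℕ} [hn : n.AtLeastTwo] {H : Subgroup (BraidGroup n)}

/-- The element `[T, g, S]` given by forests `T`, `S` and a labelled braid from the leaves of `T` to
those of `S`. -/
def ofForests {m : ℕ} (T : Forest n r m) (g : LabelledBraid n m H) (S : Forest n r m) : BV n r H :=
  mk ⟨m, T.1, S.1, T.2.1, S.2.1, T.2.2, S.2.2, g⟩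

section ofForests

variable {m : ℕ}

theorem ofForests_mul (T S U : Forest n r m) (g g' : LabelledBraid n m H) :
    ofForests T g S * ofForests S g' U = ofForests T (g * g') U :=
  mk_mul_mk (.mk _ _ _ _ _ _ _ _ _ _ _ _)

theorem ofForests_one (T : Forest n r m) : ofForests T (1 : LabelledBraid n m H) T = 1 :=
  mk_id T.2.1 T.2.2

theorem ofForests_inv (T S : Forest n r m) (g : LabelledBraid n m H) :
    (ofForests T g S)⁻¹ = ofForests S g⁻¹ T := rfl

/-- The labelled braids on the leaves of a forest form a subgroup of `BV n r H`. -/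
def ofForestsHom (T : Forest n r m) : LabelledBraid n m H →* BV n r H where
  toFun g := ofForests T g T
  map_one' := ofForests_one T
  map_mul' g g' := (ofForests_mul T T T g g').symm

/-- Expansion at a strand with the same position at the top and at the bottom. -/
theorem ofForests_expand (T S : Forest n r m) (g : LabelledBraid n m H) {i : ℕ} (hi : i < m)
    (hp : strandPerm m g.braid i = i) :
    ofForests (T.caret i hi) (expand i g) (S.caret i hi) = ofForests T g S := by
  refine Eq.trans (congrArg mk ?_) (mk_expand _ i hi)
  exact ForestPair.mk_congr (by rw [hp]; rfl) rfl rfl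

theorem ofForests_one_expand {m' : ℕ} (T S : Forest n r m) {T' S' : Forest n r m'} (i : ℕ)
    (hi : i < m) (hT : T'.1 = appendCaret T.1 i) (hS : S'.1 = appendCaret S.1 i) :
    ofForests T' (1 : LabelledBraid n _ H) S' = ofForests T 1 S := by
  obtain rfl : m + n - 1 = m' := by
    rw [← T'.2.2, hT, length_appendCaret _ (by rw [T.2.2]; exact hi), T.2.2]
  rw [← ofForests_expand T S 1 hi (by simp), expand_one]
  exact congrArg₂ (fun A B => ofForests A 1 B) (Subtype.ext hT) (Subtype.ext hS)

theorem ofForests_ofBraid_expand (T : Forest n r m) {i k : ℕ} (hi : i < m) (hk : k + 1 < m)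
    (h : i < k ∨ k + 1 < i) :
    ofForests (T.caret i hi) (ofBraid (sigma _ (shift n i k)) : LabelledBraid n _ H)
      (T.caret i hi) = ofForests T (ofBraid (sigma m k)) T := by
  have hp : strandPerm m (sigma m k) i = i := by
    rw [strandPerm_sigma hk]
    split_ifs <;> omega
  rw [← ofForests_expand T T _ hi hp, expand_ofBraid, cable_sigma _ hk]
  unfold shift
  rcases h with h | h
  · rw [if_neg (by omega), cableGen_lt h]
  · rw [if_pos (by omega), cableGen_gt h]

theorem ofForests_single_expand (T : Forest n r m) {i : ℕ} (hi : i < m) (j : Fin m) (h : i ≠ j)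
    (x : H) :
    ofForests (T.caret i hi) (single ⟨shift n i j, ForestPair.shift_lt j.2⟩ x) (T.caret i hi) =
      ofForests T (single j x) T := by
  rw [← ofForests_expand T T _ hi (by simp [single]), expand_single j h]

end ofForests

variable [hr : NeZero r]

/-! ### Elements without braiding and labels -/

variable (H) in
/-- The element `[C ∧ i, 1, C']`, where `C ∧ i` is the comb `C` with `c` carets and an additional
caret at the `i`-th leaf, and `C'` is the comb with `c + 1` carets. -/
def combCaret (c i : ℕ) (hi : i < leaves n r c) : BV n r H :=
  ofForests ((comb n r c).caret i hi) 1 (comb n r (c + 1))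

theorem combCaret_last {c i : ℕ} (hi : i < leaves n r c) (h : i + 1 = leaves n r c) :
    combCaret H c i hi = 1 := by
  obtain rfl : i = leaves n r c - 1 := by omega
  exact ofForests_one _

theorem combCaret_succ {c i : ℕ} (hi : i + 1 < leaves n r c) (hi' : i < leaves n r (c + 1)) :
    combCaret H (c + 1) i hi' = combCaret H c i (by omega) := by
  have h := lt_leaves n r (c + 1)
  exact (ofForests_one_expand _ _ (leaves n r (c + 1) - 1) (Nat.sub_lt (by omega) one_pos)
    (appendCaret_comb_last c hi).symm rfl)

theorem combCaret_mul_combCaret {c i j : ℕ} (h : i < j) (hj : j < leaves n r c)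
    (hi' : i < leaves n r (c + 1)) (hj' : j + n - 1 < leaves n r (c + 1)) :
    combCaret H c i (h.trans hj) * combCaret H (c + 1) (j + n - 1) hj' =
      combCaret H c j hj * combCaret H (c + 1) i hi' := by
  let U : Forest n r (leaves n r (c + 2)) := ((comb n r c).caret j hj).caret i hi'
  have e1 : ofForests U (1 : LabelledBraid n _ H) ((comb n r (c + 1)).caret (j + n - 1) hj') =
      combCaret H c i (h.trans hj) :=
    ofForests_one_expand _ _ _ hj' (appendCaret_comm_lt _ h).symm rfl
  have e2 : ofForests U (1 : LabelledBraid n _ H) ((comb n r (c + 1)).caret i hi') =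
      combCaret H c j hj :=
    ofForests_one_expand _ _ _ hi' rfl rfl
  rw [← e1, ← e2]
  exact (ofForests_mul _ _ _ _ _).trans (ofForests_mul _ _ _ _ _).symm

theorem combCaret_mem {K : Subgroup (BV n r H)}
    (hK : ∀ c ≤ 2 * n, ∀ i hi, combCaret H c i hi ∈ K) (c : ℕ) :
    ∀ i hi, combCaret H c i hi ∈ K := by
  have hn2 := hn.prop
  induction c with
  | zero => exact hK 0 (by omega)
  | succ c ih =>
    by_cases hc : c + 1 ≤ 2 * n
    · exact hK _ hc
    intro i hi
    have hl := lt_leaves n r c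
    have hl' : leaves n r (c + 1) = leaves n r c + n - 1 := rfl
    rcases (by omega : i + 1 = leaves n r (c + 1) ∨ i + 1 < leaves n r c ∨
      (leaves n r c ≤ i + 1 ∧ i + 1 < leaves n r (c + 1))) with h | h | h
    · rw [combCaret_last hi h]
      exact K.one_mem
    · rw [combCaret_succ h]
      exact ih _ _
    · obtain ⟨j, rfl⟩ : ∃ j, i = j + n - 1 := ⟨i + 1 - n, by omega⟩
      have e := combCaret_mul_combCaret (H := H) (by omega : 0 < j) (by omega : j < leaves n r c)
        (by omega) hi
      rw [← eq_inv_mul_iff_mul_eq] at e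
      rw [e, combCaret_succ (by omega)]
      exact K.mul_mem (K.inv_mem (ih _ _)) (K.mul_mem (ih _ _) (ih _ _))

/-- The elements `[T, 1, C]` with a comb `C` are products of the elements `combCaret`. -/
theorem exists_comb_mem {K : Subgroup (BV n r H)} (hK : ∀ c i hi, combCaret H c i hi ∈ K)
    {L : List (Vertex n r)} (hL : IsForest L) :
    ∃ c, ∃ h : L.length = leaves n r c, ofForests ⟨L, hL, h⟩ 1 (comb n r c) ∈ K := by
  induction hL with
  | roots => exact ⟨0, by simp [BraidedThompson.roots, leaves], 
      (congrArg (· ∈ K) (ofForests_one (comb n r 0))).mpr K.one_mem⟩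
  | @caret L i hL hi ih =>
    obtain ⟨c, h, hm⟩ := ih
    have hi' : i < leaves n r c := h ▸ hi
    refine ⟨c + 1, by rw [length_appendCaret _ hi, h]; rfl, ?_⟩
    have hm' := K.mul_mem hm (hK c i hi')
    rw [← ofForests_one_expand (T' := Forest.caret ⟨L, hL, h⟩ i hi')
      (S' := (comb n r c).caret i hi') _ _ i hi' rfl rfl] at hm'
    refine (congrArg (· ∈ K) ?_).mp hm'
    exact (ofForests_mul _ _ _ _ _).trans (by rw [mul_one]; rfl)

theorem leaves_injective : Function.Injective (leaves n r) := by
  have := hn.prop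
  refine (strictMono_nat_of_lt_succ fun c => ?_).injective
  have := lt_leaves n r c
  rw [leaves]
  omega

theorem ofForests_comb_mem {K : Subgroup (BV n r H)} (hK : ∀ c i hi, combCaret H c i hi ∈ K)
    (c : ℕ) (T : Forest n r (leaves n r c)) : ofForests T 1 (comb n r c) ∈ K := by
  obtain ⟨c', h, hm⟩ := exists_comb_mem hK T.2.1
  obtain rfl : c' = c := leaves_injective (h.symm.trans T.2.2)
  exact hm

/-! ### Elements supported on few strands -/

/-- Modulo the elements `[T, 1, S]`, the forest on which a labelled braid is placed is immaterial. -/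
theorem ofForests_mem_iff {K : Subgroup (BV n r H)} (hK : ∀ c i hi, combCaret H c i hi ∈ K)
    {c : ℕ} (T S : Forest n r (leaves n r c)) (g : LabelledBraid n (leaves n r c) H) :
    ofForests T g S ∈ K ↔ ofForests (comb n r c) g (comb n r c) ∈ K := by
  have e : ofForests T g S = ofForests T 1 (comb n r c) *
      ofForests (comb n r c) g (comb n r c) * (ofForests S 1 (comb n r c))⁻¹ := by
    rw [ofForests_inv, ofForests_mul, ofForests_mul]
    simp
  rw [e, K.mul_mem_cancel_right (K.inv_mem (ofForests_comb_mem hK c S)),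
    K.mul_mem_cancel_left (ofForests_comb_mem hK c T)]

theorem sigma_mem {K : Subgroup (BV n r H)} (hK : ∀ c i hi, combCaret H c i hi ∈ K)
    (hσ : ∀ c ≤ 2 * n, ∀ k, k + 1 < leaves n r c →
      ofForests (comb n r c) (ofBraid (sigma _ k)) (comb n r c) ∈ K) (c : ℕ) :
    ∀ k, k + 1 < leaves n r c →
      ofForests (comb n r c) (ofBraid (sigma _ k)) (comb n r c) ∈ K := by
  have hn2 := hn.prop
  induction c with
  | zero => exact hσ 0 (by omega)
  | succ c ih =>
    by_cases hc : c + 1 ≤ 2 * n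
    · exact hσ _ hc
    intro k hk
    have hl := lt_leaves n r (c + 1)
    have hl' : leaves n r (c + 1) = leaves n r c + n - 1 := rfl
    by_cases h : n ≤ k
    · -- A caret at the first leaf moves the crossing `n - 1` places to the right.
      have h1 := ih (k + 1 - n) (by omega)
      rw [← ofForests_ofBraid_expand _ (by omega : 0 < _) (by omega) (by omega)] at h1
      rw [show shift n 0 (k + 1 - n) = k by rw [shift, if_neg (by omega)]; omega] at h1
      exact (ofForests_mem_iff hK (c := c + 1) _ _ _).1 h1
    · have h1 := ih k (by omega)
      rw [← ofForests_ofBraid_expand _ (by omega : leaves n r c - 1 < _) (by omega) (by omega),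
        shift, if_pos (by omega)] at h1
      exact h1

theorem single_mem {K : Subgroup (BV n r H)} (hK : ∀ c i hi, combCaret H c i hi ∈ K) (x : H)
    (hx : ∀ c ≤ 2 * n, ∀ j, ofForests (comb n r c) (single j x) (comb n r c) ∈ K) (c : ℕ) :
    ∀ j, ofForests (comb n r c) (single j x) (comb n r c) ∈ K := by
  have hn2 := hn.prop
  induction c with
  | zero => exact hx 0 (by omega)
  | succ c ih =>
    by_cases hc : c + 1 ≤ 2 * n
    · exact hx _ hc
    rintro ⟨j, hj⟩
    have hl := lt_leaves n r (c + 1)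
    have hl' : leaves n r (c + 1) = leaves n r c + n - 1 := rfl
    by_cases h : n ≤ j
    · have h1 := ih ⟨j + 1 - n, by omega⟩
      rw [← ofForests_single_expand _ (by omega : 0 < _) _ (by simp only; omega)] at h1
      simp only [show shift n 0 (j + 1 - n) = j by rw [shift, if_neg (by omega)]; omega] at h1
      exact (ofForests_mem_iff hK (c := c + 1) _ _ _).1 h1
    · have h1 := ih ⟨j, by omega⟩
      rw [← ofForests_single_expand _ (by omega : leaves n r c - 1 < _) _
        (by simp only; omega)] at h1
      simp only [show shift n (leaves n r c - 1) j = j by rw [shift, if_pos (by omega)]] at h1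
      exact h1

/-! ### Finite generation -/

theorem eq_top_of_mem {K : Subgroup (BV n r H)} {X : Set H} (hX : Subgroup.closure X = ⊤)
    (hy : ∀ c ≤ 2 * n, ∀ i hi, combCaret H c i hi ∈ K)
    (hσ : ∀ c ≤ 2 * n, ∀ k, k + 1 < leaves n r c →
      ofForests (comb n r c) (ofBraid (sigma _ k)) (comb n r c) ∈ K)
    (hx : ∀ c ≤ 2 * n, ∀ j, ∀ x ∈ X, ofForests (comb n r c) (single j x) (comb n r c) ∈ K) :
    K = ⊤ := by
  have hK := combCaret_mem hy
  have htop : ∀ c, K.comap (ofForestsHom (comb n r c)) = ⊤ := fun c =>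
    eq_top_of_generators _ (sigma_mem hK hσ c) fun j => by
      have : X ⊆ (K.comap (ofForestsHom (comb n r c))).comap (single j) := fun x hxX =>
        single_mem hK x (fun c hc j => hx c hc j x hxX) c j
      rw [← Subgroup.closure_le, hX, top_le_iff] at this
      exact (Subgroup.eq_top_iff' _).1 this
  refine (Subgroup.eq_top_iff' K).2 fun a => ?_
  induction a using Quot.ind with
  | mk D =>
  obtain ⟨m, T, S, hT, hS, lT, lS, g⟩ := D
  obtain ⟨c, h, -⟩ := exists_comb_mem hK hT
  obtain rfl : m = leaves n r c := lT.symm.trans h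
  exact (ofForests_mem_iff hK ⟨T, hT, lT⟩ ⟨S, hS, lS⟩ g).2
    ((Subgroup.eq_top_iff' _).1 (htop c) g)

end BV

end BraidedThompson

theorem mainTheorem1 (n r : ℕ) [n.AtLeastTwo] (hr : 1 ≤ r)
    (H : Subgroup (BraidedThompson.BraidGroup n)) (hH : H.FG) :
    Group.FG (BraidedThompson.BV n r H) := by
  open BraidedThompson BV Forest LabelledBraid in
  have : NeZero r := ⟨by omega⟩
  obtain ⟨X, hX⟩ := Group.fg_def.1 ((Group.fg_iff_subgroup_fg H).2 hH)
  let Y : Set (BV n r H) := ⋃ c ∈ Set.Iic (2 * n),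
    (Set.range (fun i : Fin (leaves n r c) => combCaret H c i i.2) ∪
      Set.range (fun k : Fin (leaves n r c) =>
        ofForests (comb n r c) (ofBraid (sigma _ k)) (comb n r c))) ∪
      Set.range (fun p : Fin (leaves n r c) × X =>
        ofForests (comb n r c) (single p.1 (p.2 : H)) (comb n r c))
  have hY : Y.Finite := (Set.finite_Iic _).biUnion fun c _ =>
    ((Set.finite_range _).union (Set.finite_range _)).union (Set.finite_range _)
  have hsub : ∀ c ≤ 2 * n, _ ⊆ Y := fun c hc => Set.subset_biUnion_of_mem (Set.mem_Iic.2 hc)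
  refine Group.fg_iff.2 ⟨Y, eq_top_of_mem hX ?_ ?_ ?_, hY⟩
  · exact fun c hc i hi => Subgroup.subset_closure (hsub c hc (.inl (.inl ⟨⟨i, hi⟩, rfl⟩)))
  · exact fun c hc k hk =>
      Subgroup.subset_closure (hsub c hc (.inl (.inr ⟨⟨k, by omega⟩, rfl⟩)))
  · exact fun c hc j x hx => Subgroup.subset_closure (hsub c hc (.inr ⟨⟨j, ⟨x, hx⟩⟩, rfl⟩))
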